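/- Let $\mathbb{A}$ be an infinite set (of names), and work in classical logic. Let $\operatorname{Perm}(\mathbb{A})$ be the group of finite permutations of $\mathbb{A}$. A set $A\subseteq\mathbb{A}$ supports an element $x$ of a $\operatorname{Perm}(\mathbb{A})$-set if $\pi x=x$ for every $\pi$ fixing $A$ pointwise; a nominal set is a $\operatorname{Perm}(\mathbb{A})$-set all of whose elements have finite support, and $x\mathrel{\#}y$ means that $x$ and $y$ have disjoint finite supports. A $01$-substitution set is a nominal set $X$ with an equivariant map $X\times\mathbb{A}\times\{0,1\}\to X$, $(x,a,i)\mapsto x(a:=i)$, such that $a\mathrel{\#}x(a:=i)$; $x(a:=i)=x$ if $a\mathrel{\#}x$; and $x(a:=i)(a':=i')=x(a':=i')(a:=i)$ if $a\ne a'$. Morphisms are equivariant maps preserving $x(a:=i)$. Let $f:X\to Y$ be a morphism of $01$-substitution sets. For $e\in\{0,1\}$, a finite $A\subseteq\mathbb{A}$ and $a\in A$, an $e$-open $(A,a)$-box over $f$ is a pair $(u,y)$ with $y\in Y$ and $u:(A\times\{0,1\})\setminus\{(a,e)\}\to X$ such that $b\mathrel{\#}u(b,i)$, $f(u(b,i))=y(b:=i)$,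 and $u(b,i)(b':=i')=u(b',i')(b:=i)$ whenever $b\neq b'$. A filler is an $x\in X$ with $f(x)=y$ and $x(b:=i)=u(b,i)$ for all $(b,i)$ in the domain of $u$. The map $f$ is a (Kan) fibration if for $e=1$ and for $e=0$ there is a choice of a filler $\operatorname{fill}(u,y)$ for every $e$-open box such that $\operatorname{fill}(\pi(u,y))=\pi\operatorname{fill}(u,y)$ for all $\pi\in\operatorname{Perm}(\mathbb{A})$ and $\operatorname{fill}((u,y)(c:=i))=\operatorname{fill}(u,y)(c:=i)$ for every $(A,a)$-box $(u,y)$, $c\in\mathbb{A}\setminus A$ and $i\in\{0,1\}$. A map is a left map if it has the left lifting property with respect to every fibration. A path object on a fibration $f:X\to Y$ is a factorisation of the diagonal $\Delta:X\to X\times_Y X$ as a left map followed by a fibration. Let $[\mathbb{A}]X=(\mathbb{A}\times X)/{\sim}$ be the name abstraction, where $(a,x)\sim(a',x')$ iff $(c\;a)x=(c\;a')x'$ for some $c$ fresh for $a,x,a',x'$, and write $\langle a\rangle x$ for the class of $(a,x)$; it is a $01$-substitution set with $\pi\langle a\rangle x=\langle\pi a\rangle(\pi x)$ and $(\langle a\rangle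 x)(b:=i)=\langle a\rangle(x(b:=i))$ for $a\neq b$. Let $$[\mathbb{A}]_fX=\{\langle a\rangle x\in[\mathbb{A}]X \mid a\mathrel{\#}f(x)\},$$ let $r:X\to[\mathbb{A}]_fX$ be the reflexivity map $r(x)=\langle a\rangle x$ for any $a\mathrel{\#}x$, and let $p:[\mathbb{A}]_fX\to X\times_YX$ be the map $p(\langle a\rangle x)=(x(a:=0),x(a:=1))$. **Corollary.** If $f:X\to Y$ is a fibration of $01$-substitution sets, then $[\mathbb{A}]_fX$, with $r$ and $p$, is a path object on $f$: $p\circ r=\Delta$, the map $r$ is a left map, and the map $p$ is a fibration. -/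

import Mathlib

open CategoryTheory

universe u v w

set_option linter.unusedSectionVars false

namespace NomCube

/-! ### Finite permutations and nominal sets -/

/-- The group of finite permutations of `𝔸`: those moving only finitely many names. -/
def FinPerm (𝔸 : Type u) : Subgroup (Equiv.Perm 𝔸) where
  carrier := {π | {a | π a ≠ a}.Finite}
  one_mem' := by simp
  mul_mem' := by
    intro π σ hπ hσ
    refine (Set.Finite.union hπ hσ).subset ?_
    intro a ha
    by_contra h
    rw [Set.mem_union, not_or] at h
    have h1 : π a = a := not_not.1 h.1
    have h2 : σ a = a := not_not.1 h.2
    exact ha (by rw [Equiv.Perm.mul_apply, h2, h1])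
  inv_mem' := by
    intro π hπ
    refine Set.Finite.subset hπ ?_
    intro a ha h
    exact ha (by rw [Equiv.Perm.inv_eq_iff_eq]; exact h.symm)

/-- The transposition `(a b)`. -/
def swap {𝔸 : Type u} [DecidableEq 𝔸] (a b : 𝔸) : FinPerm 𝔸 :=
  ⟨Equiv.swap a b, by
    refine (Set.toFinite {a, b}).subset ?_
    intro c hc
    by_contra h
    simp only [Set.mem_insert_iff, Set.mem_singleton_iff, not_or] at h
    exact hc (Equiv.swap_apply_of_ne_of_ne h.1 h.2)⟩

/-- A nominal set: a set with an action of the finite permutations of `𝔸`, each element of which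
has a finite support. -/
class NominalSet (𝔸 : Type u) (X : Type v) extends MulAction (FinPerm 𝔸) X where
  exists_support : ∀ x : X, ∃ A : Finset 𝔸, MulAction.Supports (FinPerm 𝔸) (A : Set 𝔸) x

/-- The set of names is itself a nominal set. -/
instance (𝔸 : Type u) : NominalSet 𝔸 𝔸 where
  exists_support a := ⟨{a}, fun _ hπ => hπ (by simp)⟩

/-- `x # y`: `x` and `y` have disjoint finite supports. -/
def Fresh (𝔸 : Type u) {X : Type v} {Y : Type w} [MulAction (FinPerm 𝔸) X]
    [MulAction (FinPerm 𝔸) Y] (x : X) (y : Y) : Prop :=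
  ∃ A B : Finset 𝔸, MulAction.Supports (FinPerm 𝔸) (A : Set 𝔸) x ∧
    MulAction.Supports (FinPerm 𝔸) (B : Set 𝔸) y ∧ Disjoint A B

/-- A 01-substitution set: a nominal set with an equivariant operation `x, a, i ↦ x(a := i)`,
where `false` and `true` stand for the endpoints `0` and `1`. -/
class ZeroOneSet (𝔸 : Type u) (X : Type v) extends NominalSet 𝔸 X where
  /-- The substitution `x(a := i)`. -/
  sub : X → 𝔸 → Bool → X
  smul_sub : ∀ (π : FinPerm 𝔸) (x : X) (a : 𝔸) (i : Bool),
    π • sub x a i = sub (π • x) (π • a) i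
  fresh_sub : ∀ (x : X) (a : 𝔸) (i : Bool), Fresh 𝔸 a (sub x a i)
  sub_of_fresh : ∀ (x : X) (a : 𝔸) (i : Bool), Fresh 𝔸 a x → sub x a i = x
  sub_comm : ∀ (x : X) (a a' : 𝔸) (i i' : Bool), a ≠ a' →
    sub (sub x a i) a' i' = sub (sub x a' i') a i


/-! ### Basic facts on freshness -/

section Basic

variable {𝔸 : Type u} {X : Type v} {Y : Type w} [DecidableEq 𝔸]

theorem swap_smul (a b c : 𝔸) : swap a b • c = Equiv.swap a b c := rfl

theorem smul_swap (π : FinPerm 𝔸) (a b : 𝔸) : π * swap a b = swap (π • a) (π • b) * π := by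
  apply Subtype.ext
  change π.1 * Equiv.swap a b = Equiv.swap (π.1 a) (π.1 b) * π.1
  exact Equiv.mul_swap_eq_swap_mul _ _ _

theorem smul_swap_smul [MulAction (FinPerm 𝔸) X] (π : FinPerm 𝔸) (a b : 𝔸) (x : X) :
    π • swap a b • x = swap (π • a) (π • b) • π • x := by
  rw [← mul_smul, smul_swap, mul_smul]

theorem swap_self_smul [MulAction (FinPerm 𝔸) X] (a : 𝔸) (x : X) : swap a a • x = x := by
  have : swap a a = (1 : FinPerm 𝔸) := Subtype.ext (Equiv.swap_self a)
  rw [this, one_smul]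

theorem swap_swap_smul [MulAction (FinPerm 𝔸) X] (a b : 𝔸) (x : X) :
    swap a b • swap a b • x = x := by
  have : swap a b * swap a b = (1 : FinPerm 𝔸) := Subtype.ext (Equiv.swap_mul_self a b)
  rw [← mul_smul, this, one_smul]

theorem swap_comm' (a b : 𝔸) : swap a b = swap b a := Subtype.ext (Equiv.swap_comm a b)

variable [Infinite 𝔸]

theorem fresh_iff [MulAction (FinPerm 𝔸) X] {a : 𝔸} {x : X} :
    Fresh 𝔸 a x ↔ ∃ B : Finset 𝔸, MulAction.Supports (FinPerm 𝔸) (B : Set 𝔸) x ∧ a ∉ B := by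
  constructor
  · rintro ⟨A, B, hA, hB, hd⟩
    refine ⟨B, hB, fun haB => ?_⟩
    have haA : a ∉ A := fun h => Finset.disjoint_left.1 hd h haB
    obtain ⟨c, hc⟩ := Infinite.exists_notMem_finset (insert a A)
    rw [Finset.mem_insert, not_or] at hc
    have := hA (swap a c) (by
      intro b hb
      exact Equiv.swap_apply_of_ne_of_ne (fun h => haA (h ▸ hb)) (fun h => hc.2 (h ▸ hb)))
    rw [swap_smul, Equiv.swap_apply_left] at this
    exact hc.1 this
  · rintro ⟨B, hB, ha⟩
    exact ⟨{a}, B, fun _ h => h (by simp), hB, by simpa using ha⟩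

theorem fresh_name {a b : 𝔸} : Fresh 𝔸 a b ↔ a ≠ b := by
  rw [fresh_iff]
  constructor
  · rintro ⟨B, hB, ha⟩ rfl
    obtain ⟨c, hc⟩ := Infinite.exists_notMem_finset (insert a B)
    rw [Finset.mem_insert, not_or] at hc
    have := hB (swap a c) (by
      intro b hb
      exact Equiv.swap_apply_of_ne_of_ne (fun h => ha (h ▸ hb)) (fun h => hc.2 (h ▸ hb)))
    rw [swap_smul, Equiv.swap_apply_left] at this
    exact hc.1 this
  · intro h
    exact ⟨{b}, fun _ h => h (by simp), by simpa using h⟩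

theorem exists_fresh [NominalSet 𝔸 X] (F : Finset 𝔸) (x : X) : ∃ a, a ∉ F ∧ Fresh 𝔸 a x := by
  obtain ⟨B, hB⟩ := NominalSet.exists_support (𝔸 := 𝔸) x
  obtain ⟨a, ha⟩ := Infinite.exists_notMem_finset (F ∪ B)
  rw [Finset.mem_union, not_or] at ha
  exact ⟨a, ha.1, fresh_iff.2 ⟨B, hB, ha.2⟩⟩

theorem supports_smul [MulAction (FinPerm 𝔸) X] {B : Finset 𝔸} {x : X}
    (h : MulAction.Supports (FinPerm 𝔸) (B : Set 𝔸) x) (π : FinPerm 𝔸) :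
    MulAction.Supports (FinPerm 𝔸) ((B.image (fun b => π • b) : Finset 𝔸) : Set 𝔸) (π • x) := by
  intro σ hσ
  have := h (π⁻¹ * σ * π) (by
    intro b hb
    have := @hσ (π • b) (Finset.mem_coe.2 (Finset.mem_image_of_mem _ (Finset.mem_coe.1 hb)))
    rw [mul_smul, mul_smul, this, inv_smul_smul])
  rw [mul_smul, mul_smul, inv_smul_eq_iff] at this
  exact this

theorem Fresh.smul [MulAction (FinPerm 𝔸) X] {a : 𝔸} {x : X} (h : Fresh 𝔸 a x)
    (π : FinPerm 𝔸) : Fresh 𝔸 (π • a) (π • x) := by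
  obtain ⟨B, hB, ha⟩ := fresh_iff.1 h
  refine fresh_iff.2 ⟨_, supports_smul hB π, ?_⟩
  simpa using ha

theorem swap_smul_of_fresh [MulAction (FinPerm 𝔸) X] {a b : 𝔸} {x : X} (ha : Fresh 𝔸 a x)
    (hb : Fresh 𝔸 b x) : swap a b • x = x := by
  obtain ⟨A, hA, ha⟩ := fresh_iff.1 ha
  obtain ⟨B, hB, hb⟩ := fresh_iff.1 hb
  by_cases hab : a = b
  · subst hab; exact swap_self_smul _ _
  obtain ⟨c, hc⟩ := Infinite.exists_notMem_finset (insert a (insert b (A ∪ B)))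
  simp only [Finset.mem_insert, Finset.mem_union, not_or] at hc
  have h1 : swap a c • x = x := hA _ (by
    intro d hd
    exact Equiv.swap_apply_of_ne_of_ne (fun h => ha (h ▸ hd)) (fun h => hc.2.2.1 (h ▸ hd)))
  have h2 : swap b c • x = x := hB _ (by
    intro d hd
    exact Equiv.swap_apply_of_ne_of_ne (fun h => hb (h ▸ hd)) (fun h => hc.2.2.2 (h ▸ hd)))
  have h3 := smul_swap_smul (swap b c) a c x
  rw [h1, h2, swap_smul, swap_smul, Equiv.swap_apply_right,
    Equiv.swap_apply_of_ne_of_ne hab (fun h => hc.1 h.symm)] at h3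
  exact h3.symm

theorem Fresh.map [MulAction (FinPerm 𝔸) X] [MulAction (FinPerm 𝔸) Y] {a : 𝔸} {x : X}
    (h : Fresh 𝔸 a x) (f : X → Y) (hf : ∀ (π : FinPerm 𝔸) x, f (π • x) = π • f x) :
    Fresh 𝔸 a (f x) := by
  obtain ⟨B, hB, ha⟩ := fresh_iff.1 h
  refine fresh_iff.2 ⟨B, ?_, ha⟩
  intro π hπ
  rw [← hf, hB π hπ]

theorem Fresh.sub [ZeroOneSet 𝔸 X] {a : 𝔸} {x : X} (h : Fresh 𝔸 a x) (b : 𝔸) (i : Bool) :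
    Fresh 𝔸 a (ZeroOneSet.sub x b i) := by
  by_cases hab : a = b
  · subst hab; exact ZeroOneSet.fresh_sub _ _ _
  obtain ⟨B, hB, ha⟩ := fresh_iff.1 h
  refine fresh_iff.2 ⟨insert b B, fun π hπ => ?_, by simp [hab, ha]⟩
  rw [ZeroOneSet.smul_sub, hB π (fun c hc => hπ (by simp at hc ⊢; exact Or.inr hc)),
    hπ (by simp)]

end Basic

/-! ### The category of 01-substitution sets -/

/-- A 01-substitution set, bundled. -/
structure ZeroOneSub (𝔸 : Type u) where
  /-- The underlying set. -/
  carrier : Type u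
  [str : ZeroOneSet 𝔸 carrier]

attribute [instance] ZeroOneSub.str

instance (𝔸 : Type u) : CoeSort (ZeroOneSub 𝔸) (Type u) := ⟨ZeroOneSub.carrier⟩

/-- A morphism of 01-substitution sets: an equivariant map preserving substitution. -/
@[ext]
structure Hom {𝔸 : Type u} (X Y : ZeroOneSub 𝔸) where
  /-- The underlying function. -/
  toFun : X → Y
  map_smul : ∀ (π : FinPerm 𝔸) (x : X), toFun (π • x) = π • toFun x
  map_sub : ∀ (x : X) (a : 𝔸) (i : Bool),
    toFun (ZeroOneSet.sub x a i) = ZeroOneSet.sub (toFun x) a i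

instance {𝔸 : Type u} (X Y : ZeroOneSub 𝔸) : FunLike (Hom X Y) X Y where
  coe := Hom.toFun
  coe_injective _ _ h := Hom.ext h

instance (𝔸 : Type u) : Category (ZeroOneSub 𝔸) where
  Hom X Y := Hom X Y
  id X := ⟨fun x => x, fun _ _ => rfl, fun _ _ _ => rfl⟩
  comp f g := ⟨fun x => g.toFun (f.toFun x),
    fun π x => by rw [f.map_smul, g.map_smul], fun x a i => by rw [f.map_sub, g.map_sub]⟩

instance (𝔸 : Type u) : ConcreteCategory (ZeroOneSub 𝔸) (fun X Y => Hom X Y) where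
  hom f := f
  ofHom f := f

theorem map_smul {𝔸 : Type u} {X Y : ZeroOneSub 𝔸} (f : X ⟶ Y) (π : FinPerm 𝔸) (x : X) :
    f (π • x) = π • f x := Hom.map_smul f π x

theorem map_sub {𝔸 : Type u} {X Y : ZeroOneSub 𝔸} (f : X ⟶ Y) (x : X) (a : 𝔸) (i : Bool) :
    f (ZeroOneSet.sub x a i) = ZeroOneSet.sub (f x) a i := Hom.map_sub f x a i

section Main

variable {𝔸 : Type u} [DecidableEq 𝔸] [Infinite 𝔸]

/-! ### Open boxes and Kan fibrations -/

/-- The set `(A × 2) \ {(a, e)}` of faces of an `e`-open `(A, a)`-box. -/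
abbrev Faces (A : Finset 𝔸) (a : 𝔸) (e : Bool) : Type u :=
  {p : 𝔸 × Bool // p.1 ∈ A ∧ p ≠ (a, e)}

/-- An `e`-open box `(u, y)` over `f`, together with its `(A, a)`. The adjacency condition relates
faces in two distinct directions. -/
structure OpenBox {X Y : ZeroOneSub 𝔸} (f : X ⟶ Y) (e : Bool) where
  /-- The directions of the box. -/
  A : Finset 𝔸
  /-- The direction of the missing face. -/
  a : 𝔸
  mem : a ∈ A
  /-- The faces. -/
  u : Faces A a e → X
  /-- The element of the base. -/
  y : Y
  fresh : ∀ p, Fresh 𝔸 p.1.1 (u p)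
  adj : ∀ p q : Faces A a e, p.1.1 ≠ q.1.1 →
    ZeroOneSet.sub (u p) q.1.1 q.1.2 = ZeroOneSet.sub (u q) p.1.1 p.1.2
  lies_over : ∀ p, f (u p) = ZeroOneSet.sub y p.1.1 p.1.2

namespace OpenBox

variable {X Y : ZeroOneSub 𝔸} {f : X ⟶ Y} {e : Bool}

theorem permAux (π : FinPerm 𝔸) {A : Finset 𝔸} {a : 𝔸} {e : Bool}
    (p : Faces (A.image (fun b => π • b)) (π • a) e) :
    (π⁻¹ • p.1.1, p.1.2).1 ∈ A ∧ (π⁻¹ • p.1.1, p.1.2) ≠ (a, e) := by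
  obtain ⟨⟨b, i⟩, hb, hne⟩ := p
  obtain ⟨c, hc, rfl⟩ := Finset.mem_image.1 hb
  refine ⟨by simpa using hc, fun h => hne ?_⟩
  simp only [inv_smul_smul, Prod.mk.injEq] at h
  rw [h.1, h.2]

/-- The action of a finite permutation on open boxes: an `(A, a)`-box is sent to a
`(π A, π a)`-box, with faces `(π u)(b, i) = π (u (π⁻¹ b, i))`. -/
def perm (π : FinPerm 𝔸) (B : OpenBox f e) : OpenBox f e where
  A := B.A.image (fun b => π • b)
  a := π • B.a
  mem := Finset.mem_image_of_mem _ B.mem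
  u p := π • B.u ⟨(π⁻¹ • p.1.1, p.1.2), permAux π p⟩
  y := π • B.y
  fresh p := by
    have := (B.fresh ⟨(π⁻¹ • p.1.1, p.1.2), permAux π p⟩).smul π
    simpa only [smul_inv_smul] using this
  adj p q hpq := by
    have := congrArg (π • ·) (B.adj ⟨(π⁻¹ • p.1.1, p.1.2), permAux π p⟩
      ⟨(π⁻¹ • q.1.1, q.1.2), permAux π q⟩
      (fun h => hpq (smul_left_cancel _ h)))
    simpa only [ZeroOneSet.smul_sub, smul_inv_smul] using this
  lies_over p := by
    rw [map_smul, B.lies_over, ZeroOneSet.smul_sub, smul_inv_smul]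

/-- The substitution `(u, y)(c := i)`, for `c` not among the directions of the box. -/
def sub (B : OpenBox f e) (c : 𝔸) (i : Bool) (hc : c ∉ B.A) : OpenBox f e where
  A := B.A
  a := B.a
  mem := B.mem
  u p := ZeroOneSet.sub (B.u p) c i
  y := ZeroOneSet.sub B.y c i
  fresh p := (B.fresh p).sub c i
  adj p q hpq := by
    rw [ZeroOneSet.sub_comm _ _ _ _ _ (fun h : c = q.1.1 => hc (h ▸ q.2.1)), B.adj p q hpq,
      ZeroOneSet.sub_comm _ _ _ _ _ (fun h : p.1.1 = c => hc (h ▸ p.2.1))]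
  lies_over p := by
    rw [map_sub, B.lies_over, ZeroOneSet.sub_comm _ _ _ _ _ (fun h : p.1.1 = c => hc (h ▸ p.2.1))]

/-- `x` is a filler for the open box `B`. -/
def IsFiller (B : OpenBox f e) (x : X) : Prop :=
  (∀ p, ZeroOneSet.sub x p.1.1 p.1.2 = B.u p) ∧ f x = B.y

end OpenBox

/-- A Kan filling operator for `e`-open boxes over `f`: a choice of fillers which is uniform. -/
structure KanFilling {X Y : ZeroOneSub 𝔸} (f : X ⟶ Y) (e : Bool) where
  /-- The chosen filler. -/
  fill : OpenBox f e → X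
  isFiller : ∀ B : OpenBox f e, B.IsFiller (fill B)
  fill_perm : ∀ (π : FinPerm 𝔸) (B : OpenBox f e), fill (B.perm π) = π • fill B
  fill_sub : ∀ (B : OpenBox f e) (c : 𝔸) (i : Bool) (hc : c ∉ B.A),
    fill (B.sub c i hc) = ZeroOneSet.sub (fill B) c i

variable (𝔸) in
/-- The class of Kan fibrations: the maps admitting Kan filling operators for `1`-open boxes and
for `0`-open boxes. -/
def kanFibrations : MorphismProperty (ZeroOneSub 𝔸) := fun _ _ f =>
  Nonempty (KanFilling f true) ∧ Nonempty (KanFilling f false)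

variable (𝔸) in
/-- The class of left maps: the maps with the left lifting property against all Kan fibrations. -/
def leftMaps : MorphismProperty (ZeroOneSub 𝔸) := (kanFibrations 𝔸).llp

/-! ### Products, subobjects, fibre products -/

theorem supports_union_left {X : Type v} [MulAction (FinPerm 𝔸) X] {A : Finset 𝔸} {x : X}
    (h : MulAction.Supports (FinPerm 𝔸) (A : Set 𝔸) x) (B : Finset 𝔸) :
    MulAction.Supports (FinPerm 𝔸) ((A ∪ B : Finset 𝔸) : Set 𝔸) x :=
  h.mono (by simp)

theorem supports_union_right {X : Type v} [MulAction (FinPerm 𝔸) X] {B : Finset 𝔸} {x : X}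
    (h : MulAction.Supports (FinPerm 𝔸) (B : Set 𝔸) x) (A : Finset 𝔸) :
    MulAction.Supports (FinPerm 𝔸) ((A ∪ B : Finset 𝔸) : Set 𝔸) x :=
  h.mono (by simp)

/-- The componentwise structure on a binary product. -/
instance prodZeroOneSet (X : Type v) (Y : Type w) [ZeroOneSet 𝔸 X] [ZeroOneSet 𝔸 Y] :
    ZeroOneSet 𝔸 (X × Y) where
  exists_support := by
    rintro ⟨x, y⟩
    obtain ⟨A, hA⟩ := NominalSet.exists_support (𝔸 := 𝔸) x
    obtain ⟨B, hB⟩ := NominalSet.exists_support (𝔸 := 𝔸) y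
    exact ⟨A ∪ B, fun π hπ => Prod.ext (supports_union_left hA B π hπ)
      (supports_union_right hB A π hπ)⟩
  sub z a i := (ZeroOneSet.sub z.1 a i, ZeroOneSet.sub z.2 a i)
  smul_sub π z a i := Prod.ext (ZeroOneSet.smul_sub π z.1 a i) (ZeroOneSet.smul_sub π z.2 a i)
  fresh_sub z a i := by
    obtain ⟨A, hA, ha⟩ := fresh_iff.1 (ZeroOneSet.fresh_sub z.1 a i)
    obtain ⟨B, hB, hb⟩ := fresh_iff.1 (ZeroOneSet.fresh_sub z.2 a i)
    refine fresh_iff.2 ⟨A ∪ B, fun π hπ => Prod.ext (supports_union_left hA B π hπ)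
      (supports_union_right hB A π hπ), by simp [ha, hb]⟩
  sub_of_fresh z a i h := Prod.ext
    (ZeroOneSet.sub_of_fresh _ _ _ (h.map Prod.fst fun _ _ => rfl))
    (ZeroOneSet.sub_of_fresh _ _ _ (h.map Prod.snd fun _ _ => rfl))
  sub_comm z a a' i i' h := Prod.ext (ZeroOneSet.sub_comm _ _ _ _ _ h)
    (ZeroOneSet.sub_comm _ _ _ _ _ h)

/-- The structure on a subset closed under permutations and substitutions. -/
@[reducible]
def subZeroOneSet {X : Type v} [ZeroOneSet 𝔸 X] (P : X → Prop)
    (hp : ∀ (π : FinPerm 𝔸) (x : X), P x → P (π • x))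
    (hs : ∀ x : X, P x → ∀ (a : 𝔸) (i : Bool), P (ZeroOneSet.sub x a i)) :
    ZeroOneSet 𝔸 {x : X // P x} where
  smul π x := ⟨π • x.1, hp π x.1 x.2⟩
  one_smul x := Subtype.ext (one_smul _ x.1)
  mul_smul π σ x := Subtype.ext (mul_smul π σ x.1)
  exists_support x := by
    obtain ⟨A, hA⟩ := NominalSet.exists_support (𝔸 := 𝔸) x.1
    exact ⟨A, fun π hπ => Subtype.ext (hA π hπ)⟩
  sub x a i := ⟨ZeroOneSet.sub x.1 a i, hs x.1 x.2 a i⟩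
  smul_sub π x a i := Subtype.ext (ZeroOneSet.smul_sub π x.1 a i)
  fresh_sub x a i := by
    obtain ⟨A, B, hA, hB, hd⟩ := ZeroOneSet.fresh_sub x.1 a i
    exact ⟨A, B, hA, fun π hπ => Subtype.ext (hB π hπ), hd⟩
  sub_of_fresh x a i h := by
    obtain ⟨A, B, hA, hB, hd⟩ := h
    exact Subtype.ext (ZeroOneSet.sub_of_fresh _ _ _
      ⟨A, B, hA, fun π hπ => congrArg Subtype.val (hB π hπ), hd⟩)
  sub_comm x a a' i i' h := Subtype.ext (ZeroOneSet.sub_comm _ _ _ _ _ h)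

/-- The fibre product `X ×_Y X = {(x₁, x₂) | f x₁ = f x₂}`. -/
def fibreProd {X Y : ZeroOneSub 𝔸} (f : X ⟶ Y) : ZeroOneSub 𝔸 where
  carrier := {z : X × X // f z.1 = f z.2}
  str := subZeroOneSet _
    (fun π z hz => by
      change f (π • z.1) = f (π • z.2)
      rw [map_smul, map_smul, hz])
    (fun z hz a i => by
      change f (ZeroOneSet.sub z.1 a i) = f (ZeroOneSet.sub z.2 a i)
      rw [map_sub, map_sub, hz])

/-- The first projection. -/
def fibreFst {X Y : ZeroOneSub 𝔸} (f : X ⟶ Y) : fibreProd f ⟶ X :=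
  Hom.mk (fun z => z.1.1) (fun _ _ => rfl) (fun _ _ _ => rfl)

/-- The second projection. -/
def fibreSnd {X Y : ZeroOneSub 𝔸} (f : X ⟶ Y) : fibreProd f ⟶ X :=
  Hom.mk (fun z => z.1.2) (fun _ _ => rfl) (fun _ _ _ => rfl)

/-- The fibre product is a pullback. -/
theorem isPullback_fibreProd {X Y : ZeroOneSub 𝔸} (f : X ⟶ Y) :
    IsPullback (fibreFst f) (fibreSnd f) f f where
  w := Hom.ext (funext fun z => z.2)
  isLimit' := ⟨Limits.PullbackCone.IsLimit.mk _
    (fun s => Hom.mk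
      (fun t => ⟨(s.fst t, s.snd t), congrFun (congrArg Hom.toFun s.condition) t⟩)
      (fun π t => Subtype.ext (Prod.ext (map_smul s.fst π t) (map_smul s.snd π t)))
      (fun t a i => Subtype.ext (Prod.ext (map_sub s.fst t a i) (map_sub s.snd t a i))))
    (fun _ => rfl) (fun _ => rfl)
    (fun _ _ h₁ h₂ => Hom.ext (funext fun t => Subtype.ext (Prod.ext
      (congrFun (congrArg Hom.toFun h₁) t) (congrFun (congrArg Hom.toFun h₂) t))))⟩

/-! ### Path objects -/

/-- For classes `L`, `R` of maps and a pullback `D` of `f` along itself: `P`, together with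
`r : X ⟶ P` and `p : P ⟶ D`, is a path object on `f`, that is, `r` followed by `p` is a
factorisation of the diagonal `X ⟶ D` into a map in `L` followed by a map in `R`. -/
structure IsPathObject {C : Type v} [Category.{w} C] (L R : MorphismProperty C) {X Y D P : C}
    {f : X ⟶ Y} {d₁ d₂ : D ⟶ X} (sq : IsPullback d₁ d₂ f f) (r : X ⟶ P) (p : P ⟶ D) : Prop where
  fac : r ≫ p = sq.lift (𝟙 X) (𝟙 X) rfl
  left : L r
  right : R p

/-! ### Name abstraction -/

section NameAbs

variable (𝔸) in
/-- `α`-equivalence on `𝔸 × X`. -/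
def AlphaEq {X : Type v} [NominalSet 𝔸 X] (p q : 𝔸 × X) : Prop :=
  ∃ c : 𝔸, Fresh 𝔸 c p.1 ∧ Fresh 𝔸 c p.2 ∧ Fresh 𝔸 c q.1 ∧ Fresh 𝔸 c q.2 ∧
    swap c p.1 • p.2 = swap c q.1 • q.2

variable {X : Type v}

theorem alphaEq_iff [NominalSet 𝔸 X] {a a' : 𝔸} {x x' : X} :
    AlphaEq 𝔸 (a, x) (a', x') ↔ (a = a' ∨ Fresh 𝔸 a' x) ∧ x' = swap a a' • x := by
  constructor
  · rintro ⟨c, h1, h2, h3, h4, h⟩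
    simp only [fresh_name] at h1 h2 h3 h4 h
    by_cases haa : a = a'
    · subst haa
      rw [smul_left_cancel_iff] at h
      exact ⟨Or.inl rfl, by rw [h, swap_self_smul]⟩
    · have h5 : Fresh 𝔸 a' x := by
        have := (h4.smul (swap c a')).smul (swap c a)
        rw [← h, swap_swap_smul] at this
        simpa only [swap_smul, Equiv.swap_apply_left,
          Equiv.swap_apply_of_ne_of_ne h3.symm (Ne.symm haa)] using this
      refine ⟨Or.inr h5, ?_⟩
      have h6 : x' = swap c a' • swap c a • x := by rw [h, swap_swap_smul]
      rw [h6, smul_swap_smul, swap_smul_of_fresh h2 h5, swap_smul, swap_smul,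
        Equiv.swap_apply_left, Equiv.swap_apply_of_ne_of_ne h1.symm haa, swap_comm']
  · rintro ⟨h, rfl⟩
    obtain ⟨c, hc, hcx⟩ := exists_fresh (𝔸 := 𝔸) {a, a'} x
    simp only [Finset.mem_insert, Finset.mem_singleton, not_or] at hc
    refine ⟨c, fresh_name.2 hc.1, hcx, fresh_name.2 hc.2, ?_, ?_⟩
    · have := hcx.smul (swap a a')
      rwa [swap_smul, Equiv.swap_apply_of_ne_of_ne hc.1 hc.2] at this
    · dsimp only
      rcases h with rfl | h
      · rw [swap_self_smul]
      · by_cases haa : a = a'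
        · subst haa; rw [swap_self_smul]
        rw [smul_swap_smul, swap_smul_of_fresh hcx h, swap_smul, swap_smul,
          Equiv.swap_apply_right, Equiv.swap_apply_of_ne_of_ne (Ne.symm hc.1) haa, swap_comm']

variable (𝔸) in
theorem alphaEq_equivalence (X : Type v) [NominalSet 𝔸 X] :
    Equivalence (AlphaEq 𝔸 (X := X)) where
  refl p := alphaEq_iff.2 ⟨Or.inl rfl, (swap_self_smul _ _).symm⟩
  symm := by
    rintro p q ⟨c, h1, h2, h3, h4, h⟩
    exact ⟨c, h3, h4, h1, h2, h.symm⟩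
  trans := by
    rintro ⟨a, x⟩ ⟨b, y⟩ ⟨c, z⟩ h h'
    obtain ⟨h1, rfl⟩ := alphaEq_iff.1 h
    obtain ⟨h2, rfl⟩ := alphaEq_iff.1 h'
    obtain ⟨d, hd, hdx⟩ := exists_fresh (𝔸 := 𝔸) {a, b, c} x
    simp only [Finset.mem_insert, Finset.mem_singleton, not_or] at hd
    have hdy : Fresh 𝔸 d (swap a b • x) := by
      have := hdx.smul (swap a b)
      rwa [swap_smul, Equiv.swap_apply_of_ne_of_ne hd.1 hd.2.1] at this
    have hdz : Fresh 𝔸 d (swap b c • swap a b • x) := by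
      have := hdy.smul (swap b c)
      rwa [swap_smul, Equiv.swap_apply_of_ne_of_ne hd.2.1 hd.2.2] at this
    have key : ∀ {e g : 𝔸} {y : X}, (e = g ∨ Fresh 𝔸 g y) → d ≠ e → d ≠ g → Fresh 𝔸 d y →
        swap d e • y = swap d g • swap e g • y := by
      rintro e g y (rfl | hg) hde hdg hdy
      · rw [swap_self_smul]
      · by_cases heg : e = g
        · subst heg; rw [swap_self_smul]
        rw [smul_swap_smul, swap_smul_of_fresh hdy hg, swap_smul, swap_smul,
          Equiv.swap_apply_right, Equiv.swap_apply_of_ne_of_ne (Ne.symm hde) heg, swap_comm']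
    exact ⟨d, fresh_name.2 hd.1, hdx, fresh_name.2 hd.2.2, hdz,
      (key h1 hd.1 hd.2.1 hdx).trans (key h2 hd.2.1 hd.2.2 hdy)⟩

variable (𝔸) in
/-- The setoid of `α`-equivalence. -/
def alphaSetoid (X : Type v) [NominalSet 𝔸 X] : Setoid (𝔸 × X) :=
  ⟨AlphaEq 𝔸, alphaEq_equivalence 𝔸 X⟩

variable (𝔸) in
/-- The name abstraction `[𝔸]X`. -/
def NameAbs (X : Type v) [NominalSet 𝔸 X] : Type (max u v) := Quotient (alphaSetoid 𝔸 X)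

namespace NameAbs

/-- The class `⟨a⟩x`. -/
def mk [NominalSet 𝔸 X] (a : 𝔸) (x : X) : NameAbs 𝔸 X := Quotient.mk (alphaSetoid 𝔸 X) (a, x)

theorem mk_eq_mk [NominalSet 𝔸 X] {a a' : 𝔸} {x x' : X} :
    mk a x = mk a' x' ↔ (a = a' ∨ Fresh 𝔸 a' x) ∧ x' = swap a a' • x :=
  Quotient.eq.trans alphaEq_iff

theorem mk_injective [NominalSet 𝔸 X] {a : 𝔸} {x x' : X} (h : mk a x = mk a x') : x = x' := by
  rw [(mk_eq_mk.1 h).2, swap_self_smul]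

theorem exists_rep [NominalSet 𝔸 X] (F : Finset 𝔸) (w : NameAbs 𝔸 X) :
    ∃ a x, a ∉ F ∧ w = mk a x := by
  obtain ⟨⟨a, x⟩, rfl⟩ := Quotient.exists_rep w
  obtain ⟨b, hb, hbx⟩ := exists_fresh F x
  exact ⟨b, swap a b • x, hb, mk_eq_mk.2 ⟨Or.inr hbx, rfl⟩⟩

/-- The action `π ⟨a⟩x = ⟨π a⟩(π x)`. -/
instance [NominalSet 𝔸 X] : MulAction (FinPerm 𝔸) (NameAbs 𝔸 X) where
  smul π := Quotient.lift (fun p => mk (π • p.1) (π • p.2)) (by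
    rintro ⟨a, x⟩ ⟨a', x'⟩ h
    obtain ⟨h', rfl⟩ := alphaEq_iff.1 h
    refine mk_eq_mk.2 ⟨?_, smul_swap_smul _ _ _ _⟩
    rcases h' with rfl | h'
    · exact Or.inl rfl
    · exact Or.inr (h'.smul π))
  one_smul := by
    rintro ⟨a, x⟩
    change mk ((1 : FinPerm 𝔸) • a) ((1 : FinPerm 𝔸) • x) = mk a x
    rw [one_smul, one_smul]
  mul_smul := by
    rintro π σ ⟨a, x⟩
    change mk ((π * σ) • a) ((π * σ) • x) = mk (π • σ • a) (π • σ • x)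
    rw [mul_smul, mul_smul]

theorem smul_mk [NominalSet 𝔸 X] (π : FinPerm 𝔸) (a : 𝔸) (x : X) :
    π • mk a x = mk (π • a) (π • x) := rfl

instance [NominalSet 𝔸 X] : NominalSet 𝔸 (NameAbs 𝔸 X) where
  exists_support := by
    rintro ⟨a, x⟩
    obtain ⟨A, hA⟩ := NominalSet.exists_support (𝔸 := 𝔸) x
    refine ⟨insert a A, fun π hπ => ?_⟩
    change mk (π • a) (π • x) = mk a x
    rw [hπ (by simp), hA π (fun b hb => hπ (by simp at hb ⊢; exact Or.inr hb))]

theorem fresh_mk_of_fresh [NominalSet 𝔸 X] {a b : 𝔸} {x : X} (hab : b ≠ a) (h : Fresh 𝔸 b x) :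
    Fresh 𝔸 b (mk a x) := by
  obtain ⟨A, hA, hb⟩ := fresh_iff.1 h
  refine fresh_iff.2 ⟨insert a A, fun π hπ => ?_, by simp [hab, hb]⟩
  rw [smul_mk, hπ (by simp), hA π (fun b hb => hπ (by simp at hb ⊢; exact Or.inr hb))]

theorem fresh_of_fresh_mk [NominalSet 𝔸 X] {a b : 𝔸} {x : X} (hab : b ≠ a)
    (h : Fresh 𝔸 b (mk a x)) : Fresh 𝔸 b x := by
  obtain ⟨c, hc, hcx⟩ := exists_fresh (𝔸 := 𝔸) {a, b} x
  simp only [Finset.mem_insert, Finset.mem_singleton, not_or] at hc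
  have h1 := swap_smul_of_fresh h (fresh_mk_of_fresh hc.1 hcx)
  rw [smul_mk, swap_smul, Equiv.swap_apply_of_ne_of_ne (Ne.symm hab) (Ne.symm hc.1)] at h1
  have h2 := hcx.smul (swap b c)
  rwa [mk_injective h1, swap_smul, Equiv.swap_apply_right] at h2

/-- The substitution on `[𝔸]X`, determined by `(⟨a⟩x)(b := i) = ⟨a⟩(x(b := i))` for `a ≠ b`.
(If `a = b`, then `b` is fresh for `⟨a⟩x`, which is therefore left unchanged.) -/
def sub [ZeroOneSet 𝔸 X] (w : NameAbs 𝔸 X) (b : 𝔸) (i : Bool) : NameAbs 𝔸 X :=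
  Quotient.lift (fun p : 𝔸 × X => if p.1 = b then mk p.1 p.2 else mk p.1 (ZeroOneSet.sub p.2 b i))
    (by
      rintro ⟨a, x⟩ ⟨a', x'⟩ h
      have heq : mk a x = mk a' x' := Quotient.sound h
      obtain ⟨h', rfl⟩ := alphaEq_iff.1 h
      dsimp only
      by_cases haa : a = a'
      · subst haa; rw [swap_self_smul]
      replace h := h'.resolve_left haa
      by_cases hab : a = b
      · have hab' : a' ≠ b := fun h => haa (hab.trans h.symm)
        rw [if_pos hab, if_neg hab', ZeroOneSet.sub_of_fresh _ b, heq]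
        have := h.smul (swap a a')
        rw [swap_smul, Equiv.swap_apply_right] at this
        exact hab ▸ this
      · by_cases hab' : a' = b
        · rw [if_neg hab, if_pos hab', ZeroOneSet.sub_of_fresh _ b _ (hab' ▸ h), heq]
        · rw [if_neg hab, if_neg hab']
          refine mk_eq_mk.2 ⟨Or.inr (h.sub b i), ?_⟩
          rw [ZeroOneSet.smul_sub, swap_smul,
            Equiv.swap_apply_of_ne_of_ne (Ne.symm hab) (Ne.symm hab')]) w

theorem sub_mk [ZeroOneSet 𝔸 X] {a b : 𝔸} (h : a ≠ b) (x : X) (i : Bool) :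
    sub (mk a x) b i = mk a (ZeroOneSet.sub x b i) := if_neg h

theorem sub_mk_self [ZeroOneSet 𝔸 X] (a : 𝔸) (x : X) (i : Bool) :
    sub (mk a x) a i = mk a x := if_pos rfl

/-- The 01-substitution set `[𝔸]X`. -/
instance [ZeroOneSet 𝔸 X] : ZeroOneSet 𝔸 (NameAbs 𝔸 X) where
  sub := sub
  smul_sub π w b i := by
    obtain ⟨a, x, ha, rfl⟩ := exists_rep {b} w
    rw [Finset.mem_singleton] at ha
    rw [sub_mk ha, smul_mk, smul_mk, sub_mk (fun h => ha (smul_left_cancel _ h)),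
      ZeroOneSet.smul_sub]
  fresh_sub w b i := by
    obtain ⟨a, x, ha, rfl⟩ := exists_rep {b} w
    rw [Finset.mem_singleton] at ha
    rw [sub_mk ha]
    exact fresh_mk_of_fresh (Ne.symm ha) (ZeroOneSet.fresh_sub _ _ _)
  sub_of_fresh w b i h := by
    obtain ⟨a, x, ha, rfl⟩ := exists_rep {b} w
    rw [Finset.mem_singleton] at ha
    rw [sub_mk ha, ZeroOneSet.sub_of_fresh _ _ _ (fresh_of_fresh_mk (Ne.symm ha) h)]
  sub_comm w b b' i i' h := by
    obtain ⟨a, x, ha, rfl⟩ := exists_rep {b, b'} w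
    simp only [Finset.mem_insert, Finset.mem_singleton, not_or] at ha
    rw [sub_mk ha.1, sub_mk ha.2, sub_mk ha.2, sub_mk ha.1, ZeroOneSet.sub_comm _ _ _ _ _ h]

/-- The endpoint `x(a := i)` of `⟨a⟩x`. -/
def endpoint [ZeroOneSet 𝔸 X] (i : Bool) (w : NameAbs 𝔸 X) : X :=
  Quotient.lift (fun p : 𝔸 × X => ZeroOneSet.sub p.2 p.1 i) (by
    rintro ⟨a, x⟩ ⟨a', x'⟩ h
    obtain ⟨h', rfl⟩ := alphaEq_iff.1 h
    rcases h' with rfl | h'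
    · dsimp only; rw [swap_self_smul]
    · have := ZeroOneSet.smul_sub (swap a a') x a i
      rw [swap_smul_of_fresh (ZeroOneSet.fresh_sub _ _ _) (h'.sub a i), swap_smul,
        Equiv.swap_apply_left] at this
      exact this) w

theorem endpoint_mk [ZeroOneSet 𝔸 X] (i : Bool) (a : 𝔸) (x : X) :
    endpoint i (mk a x) = ZeroOneSet.sub x a i := rfl

theorem endpoint_smul [ZeroOneSet 𝔸 X] (i : Bool) (π : FinPerm 𝔸) (w : NameAbs 𝔸 X) :
    endpoint i (π • w) = π • endpoint i w := by
  obtain ⟨a, x, -, rfl⟩ := exists_rep ∅ w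
  rw [smul_mk, endpoint_mk, endpoint_mk, ZeroOneSet.smul_sub]

theorem endpoint_sub [ZeroOneSet 𝔸 X] (i : Bool) (w : NameAbs 𝔸 X) (b : 𝔸) (j : Bool) :
    endpoint i (ZeroOneSet.sub w b j) = ZeroOneSet.sub (endpoint i w) b j := by
  obtain ⟨a, x, ha, rfl⟩ := exists_rep {b} w
  rw [Finset.mem_singleton] at ha
  change endpoint i (sub (mk a x) b j) = _
  rw [sub_mk ha, endpoint_mk, endpoint_mk, ZeroOneSet.sub_comm _ _ _ _ _ (Ne.symm ha)]

variable (𝔸) in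
/-- The degenerate element `⟨a⟩x` for any `a` fresh for `x`. -/
noncomputable def degen [NominalSet 𝔸 X] (x : X) : NameAbs 𝔸 X :=
  mk (exists_fresh (𝔸 := 𝔸) ∅ x).choose x

theorem degen_eq [NominalSet 𝔸 X] {a : 𝔸} {x : X} (h : Fresh 𝔸 a x) : degen 𝔸 x = mk a x :=
  mk_eq_mk.2 ⟨Or.inr h,
    (swap_smul_of_fresh (exists_fresh (𝔸 := 𝔸) ∅ x).choose_spec.2 h).symm⟩

end NameAbs

end NameAbs

/-! ### Name abstraction over a map -/

/-- The name abstraction over `f`: `[𝔸]_f X = {⟨a⟩x | a # f x}`. -/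
def nameAbsOver {X Y : ZeroOneSub 𝔸} (f : X ⟶ Y) : ZeroOneSub 𝔸 where
  carrier := {w : NameAbs 𝔸 X // ∃ (a : 𝔸) (x : X), Fresh 𝔸 a (f x) ∧ w = NameAbs.mk a x}
  str := subZeroOneSet _
    (by
      rintro π _ ⟨a, x, h, rfl⟩
      exact ⟨π • a, π • x, by rw [map_smul]; exact h.smul π, rfl⟩)
    (by
      rintro _ ⟨a, x, h, rfl⟩ b i
      change ∃ (a' : 𝔸) (x' : X), Fresh 𝔸 a' (f x') ∧ NameAbs.sub (NameAbs.mk a x) b i = NameAbs.mk a' x'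
      by_cases hab : a = b
      · subst hab
        rw [NameAbs.sub_mk_self]
        exact ⟨a, x, h, rfl⟩
      · rw [NameAbs.sub_mk hab]
        exact ⟨a, _, by rw [map_sub]; exact h.sub b i, rfl⟩)

/-- The reflexivity map `X ⟶ [𝔸]_f X`, sending `x` to `⟨a⟩x` for `a` fresh for `x`. -/
noncomputable def reflMap {X Y : ZeroOneSub 𝔸} (f : X ⟶ Y) : X ⟶ nameAbsOver f :=
  Hom.mk
    (fun x => ⟨NameAbs.degen 𝔸 x, by
      obtain ⟨a, -, ha⟩ := exists_fresh (𝔸 := 𝔸) ∅ x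
      exact ⟨a, x, ha.map f (map_smul f), NameAbs.degen_eq ha⟩⟩)
    (fun π x => Subtype.ext (by
      obtain ⟨a, -, ha⟩ := exists_fresh (𝔸 := 𝔸) ∅ x
      change NameAbs.degen 𝔸 (π • x) = π • NameAbs.degen 𝔸 x
      rw [NameAbs.degen_eq ha, NameAbs.degen_eq (ha.smul π), NameAbs.smul_mk]))
    (fun x b i => Subtype.ext (by
      obtain ⟨a, hab, ha⟩ := exists_fresh (𝔸 := 𝔸) {b} x
      rw [Finset.mem_singleton] at hab
      change NameAbs.degen 𝔸 (ZeroOneSet.sub x b i) = NameAbs.sub (NameAbs.degen 𝔸 x) b i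
      rw [NameAbs.degen_eq ha, NameAbs.degen_eq (ha.sub b i), NameAbs.sub_mk hab]))

/-- The projection `[𝔸]_f X ⟶ X ×_Y X`, `⟨a⟩x ↦ (x(a := 0), x(a := 1))`. -/
def endpointsMap {X Y : ZeroOneSub 𝔸} (f : X ⟶ Y) : nameAbsOver f ⟶ fibreProd f :=
  Hom.mk
    (fun w => ⟨(NameAbs.endpoint false w.1, NameAbs.endpoint true w.1), by
      obtain ⟨_, a, x, h, rfl⟩ := w
      change f (ZeroOneSet.sub x a false) = f (ZeroOneSet.sub x a true)
      rw [map_sub, map_sub, ZeroOneSet.sub_of_fresh _ _ _ h, ZeroOneSet.sub_of_fresh _ _ _ h]⟩)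
    (fun π w => Subtype.ext (Prod.ext (NameAbs.endpoint_smul _ π w.1)
      (NameAbs.endpoint_smul _ π w.1)))
    (fun w b i => Subtype.ext (Prod.ext (NameAbs.endpoint_sub _ w.1 b i)
      (NameAbs.endpoint_sub _ w.1 b i)))

end Main

end NomCube

/-! The factorisation of the diagonal is immediate: both endpoints of ⟨a⟩x with a # x are x.

The map p is a fibration because an open box over p in directions A becomes, after concretion of its
faces at a name c fresh for all the data, an open box over f in directions A ∪ {c}; its two c-faces
are the components of the base element of X ×_Y X (`OpenBox.transpose`). Fill it over f and abstract
c. By uniformity under substitution, a name fresh for a box is fresh for its filler; together with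
uniformity under permutations this makes the result independent of c
(`OpenBox.mk_fill_transpose_eq`), and the new filling inherits uniformity.

For r, take a square with top k, bottom h and right side a fibration g : Z → W. Each w in [𝔸]_f X is
contracted to the constant path on its source x₀ by a path in [𝔸]_f X × Z that starts at (r x₀, k
x₀), ends over w and has components agreeing in W (`IsContraction`). The Z-component of its end is
the value of the lift at w. Nothing forces a filler of constant data to be constant in the
directions of its box, so on the image of r the contraction is decreed constant, by a classical case
distinction.

Naturality comes from induction on the size of the support (`exists_morphism_of_step`). Substituting
for a name in the support of w strictly shrinks the support, so the contraction is already known on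
the faces of w. With the two prescribed ends, these faces give a boundary in [𝔸]_f X, filled by
means of f, and then an open box in Z, filled by means of g (`exists_isContraction`). Values are
chosen at one representative per orbit, and must be invariant under its stabilizer; equivariance of
the chosen fillers provides this. This half needs only 1-open boxes and only uniformity under
permutations. -/

namespace NomCube

/-! ### Minimal supports -/

section Support

variable {𝔸 : Type u} [DecidableEq 𝔸] [Infinite 𝔸] {X : Type v}

theorem fresh_of_supports [MulAction (FinPerm 𝔸) X] {F : Finset 𝔸} {a : 𝔸} {x : X}
    (h : MulAction.Supports (FinPerm 𝔸) (F : Set 𝔸) x) (ha : a ∉ F) : Fresh 𝔸 a x :=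
  fresh_iff.2 ⟨F, h, ha⟩

theorem fresh_of_swap_smul_eq [MulAction (FinPerm 𝔸) X] {a b : 𝔸} {x : X} (hb : Fresh 𝔸 b x)
    (h : swap a b • x = x) : Fresh 𝔸 a x := by
  have := hb.smul (swap a b)
  rwa [h, swap_smul, Equiv.swap_apply_right] at this

/-- Take c fresh for x, outside A and not moved by π. If π fixes A \ {a}, its conjugate by (a c)
fixes all of A and hence x; as (a c) also fixes x, so does π. -/
theorem supports_erase [NominalSet 𝔸 X] {A : Finset 𝔸} {x : X} {a : 𝔸}
    (hA : MulAction.Supports (FinPerm 𝔸) (A : Set 𝔸) x) (ha : Fresh 𝔸 a x) :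
    MulAction.Supports (FinPerm 𝔸) ((A.erase a : Finset 𝔸) : Set 𝔸) x := by
  intro π hπ
  have hfin : {b | π.1 b ≠ b}.Finite := π.2
  obtain ⟨c, hc, hcx⟩ := exists_fresh (insert a (A ∪ hfin.toFinset)) x
  simp only [Finset.mem_insert, Finset.mem_union, Set.Finite.mem_toFinset, Set.mem_ofPred_eq,
    not_or, not_not] at hc
  obtain ⟨hca, hcA, hcπ⟩ := hc
  have hπc : π • c = c := hcπ
  have hσ : (swap a c * π * swap a c) • x = x := by
    refine hA _ fun d hd => ?_
    rw [mul_smul, mul_smul]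
    by_cases hda : d = a
    · rw [hda, swap_smul a c a, Equiv.swap_apply_left, hπc, swap_smul, Equiv.swap_apply_right]
    · have hdc : d ≠ c := fun h => hcA (h ▸ hd)
      have hd' : swap a c • d = d := Equiv.swap_apply_of_ne_of_ne hda hdc
      have : π • d = d := hπ (Finset.mem_coe.2 (Finset.mem_erase.2 ⟨hda, Finset.mem_coe.1 hd⟩))
      rw [hd', this, hd']
  have hs := swap_smul_of_fresh ha hcx
  rw [mul_smul, mul_smul, hs] at hσ
  rw [← swap_swap_smul a c (π • x), hσ, hs]

theorem exists_minimal_support [NominalSet 𝔸 X] (x : X) : ∃ A : Finset 𝔸,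
    MulAction.Supports (FinPerm 𝔸) (A : Set 𝔸) x ∧ ∀ a ∈ A, ¬ Fresh 𝔸 a x := by
  obtain ⟨A, hA⟩ := NominalSet.exists_support (𝔸 := 𝔸) x
  induction A using Finset.strongInduction with
  | H A ih =>
    by_cases h : ∃ a ∈ A, Fresh 𝔸 a x
    · obtain ⟨a, haA, ha⟩ := h
      exact ih _ (Finset.erase_ssubset haA) (supports_erase hA ha)
    · exact ⟨A, hA, fun a ha hf => h ⟨a, ha, hf⟩⟩

variable (𝔸) in
/-- The least support of `x`. -/
noncomputable def supp [NominalSet 𝔸 X] (x : X) : Finset 𝔸 := (exists_minimal_support x).choose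

theorem supports_supp [NominalSet 𝔸 X] (x : X) :
    MulAction.Supports (FinPerm 𝔸) (supp 𝔸 x : Set 𝔸) x :=
  (exists_minimal_support x).choose_spec.1

theorem mem_supp [NominalSet 𝔸 X] {a : 𝔸} {x : X} : a ∈ supp 𝔸 x ↔ ¬ Fresh 𝔸 a x :=
  ⟨(exists_minimal_support x).choose_spec.2 a,
    fun h => by_contra fun ha => h (fresh_of_supports (supports_supp x) ha)⟩

theorem notMem_supp [NominalSet 𝔸 X] {a : 𝔸} {x : X} : a ∉ supp 𝔸 x ↔ Fresh 𝔸 a x := by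
  rw [mem_supp, not_not]

theorem fresh_smul_iff [NominalSet 𝔸 X] {a : 𝔸} {x : X} (π : FinPerm 𝔸) :
    Fresh 𝔸 (π • a) (π • x) ↔ Fresh 𝔸 a x :=
  ⟨fun h => by simpa using h.smul π⁻¹, fun h => h.smul π⟩

theorem smul_mem_supp [NominalSet 𝔸 X] {a : 𝔸} {x : X} (π : FinPerm 𝔸) :
    π • a ∈ supp 𝔸 (π • x) ↔ a ∈ supp 𝔸 x := by
  rw [mem_supp, mem_supp, fresh_smul_iff]

theorem supp_smul [NominalSet 𝔸 X] (π : FinPerm 𝔸) (x : X) :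
    supp 𝔸 (π • x) = (supp 𝔸 x).image (fun a => π • a) := by
  ext a
  rw [Finset.mem_image]
  constructor
  · intro h
    refine ⟨π⁻¹ • a, ?_, smul_inv_smul _ _⟩
    rwa [← smul_mem_supp π, smul_inv_smul]
  · rintro ⟨b, hb, rfl⟩
    exact (smul_mem_supp π).2 hb

theorem card_supp_smul [NominalSet 𝔸 X] (π : FinPerm 𝔸) (x : X) :
    (supp 𝔸 (π • x)).card = (supp 𝔸 x).card := by
  rw [supp_smul]
  exact Finset.card_image_of_injective _ (MulAction.injective π)

theorem supp_sub_subset [ZeroOneSet 𝔸 X] (x : X) (c : 𝔸) (i : Bool) :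
    supp 𝔸 (ZeroOneSet.sub x c i) ⊆ supp 𝔸 x := fun a ha => by
  rw [mem_supp] at ha ⊢
  exact fun h => ha (h.sub c i)

theorem card_supp_sub_le [ZeroOneSet 𝔸 X] (x : X) (c : 𝔸) (i : Bool) :
    (supp 𝔸 (ZeroOneSet.sub x c i)).card ≤ (supp 𝔸 x).card :=
  Finset.card_le_card (supp_sub_subset x c i)

/-- This strict decrease makes induction on the size of the support possible. -/
theorem card_supp_sub_lt [ZeroOneSet 𝔸 X] {x : X} {c : 𝔸} (hc : c ∈ supp 𝔸 x) (i : Bool) :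
    (supp 𝔸 (ZeroOneSet.sub x c i)).card < (supp 𝔸 x).card :=
  Finset.card_lt_card ⟨supp_sub_subset x c i,
    fun h => mem_supp.1 (h hc) (ZeroOneSet.fresh_sub _ _ _)⟩

/-- Turns compatibility with substitution into freshness: used for fillers through `fill_sub`, and
for contractions already constructed. -/
theorem fresh_of_sub_eq [ZeroOneSet 𝔸 X] {x : X} {c : 𝔸} {i : Bool}
    (h : ZeroOneSet.sub x c i = x) : Fresh 𝔸 c x := h ▸ ZeroOneSet.fresh_sub x c i

end Support

/-! ### Concretion -/

namespace NameAbs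

variable {𝔸 : Type u} [DecidableEq 𝔸] [Infinite 𝔸] {X : Type v}

theorem fresh_mk_self [NominalSet 𝔸 X] (a : 𝔸) (x : X) : Fresh 𝔸 a (mk a x) := by
  obtain ⟨c, hc, hcx⟩ := exists_fresh {a} x
  rw [Finset.mem_singleton] at hc
  exact fresh_of_swap_smul_eq (fresh_mk_of_fresh hc hcx) (by
    rw [smul_mk, swap_smul, Equiv.swap_apply_left]
    exact (mk_eq_mk.2 ⟨Or.inr hcx, rfl⟩).symm)

theorem exists_eq_mk [NominalSet 𝔸 X] {b : 𝔸} {t : NameAbs 𝔸 X} (h : Fresh 𝔸 b t) :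
    ∃ x, t = mk b x := by
  obtain ⟨a, x, ha, rfl⟩ := exists_rep {b} t
  rw [Finset.mem_singleton] at ha
  exact ⟨swap a b • x, mk_eq_mk.2 ⟨Or.inr (fresh_of_fresh_mk (Ne.symm ha) h), rfl⟩⟩

open Classical in
/-- The concretion `t @ b` of `t` at a name `b` fresh for `t`. -/
noncomputable def conc [NominalSet 𝔸 X] (b : 𝔸) (t : NameAbs 𝔸 X) : X :=
  -- Where concretion is undefined the value is irrelevant; it is taken from some representative of
  -- `t`, as `X` is not assumed inhabited.
  if h : ∃ x, t = mk b x then h.choose else (exists_rep ∅ t).choose_spec.choose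

theorem mk_conc [NominalSet 𝔸 X] {b : 𝔸} {t : NameAbs 𝔸 X} (h : Fresh 𝔸 b t) :
    mk b (conc b t) = t := by
  have h' := exists_eq_mk h
  rw [conc, dif_pos h']
  exact h'.choose_spec.symm

theorem conc_mk [NominalSet 𝔸 X] (b : 𝔸) (x : X) : conc b (mk b x) = x :=
  mk_injective (mk_conc (fresh_mk_self b x))

theorem smul_conc [NominalSet 𝔸 X] {b : 𝔸} {t : NameAbs 𝔸 X} (h : Fresh 𝔸 b t)
    (π : FinPerm 𝔸) : π • conc b t = conc (π • b) (π • t) := by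
  obtain ⟨x, rfl⟩ := exists_eq_mk h
  rw [smul_mk, conc_mk, conc_mk]

theorem sub_conc [ZeroOneSet 𝔸 X] {b c : 𝔸} {t : NameAbs 𝔸 X} (h : Fresh 𝔸 b t) (hbc : b ≠ c)
    (i : Bool) : ZeroOneSet.sub (conc b t) c i = conc b (ZeroOneSet.sub t c i) := by
  obtain ⟨x, rfl⟩ := exists_eq_mk h
  change _ = conc b (sub (mk b x) c i)
  rw [sub_mk hbc, conc_mk, conc_mk]

theorem sub_conc_self [ZeroOneSet 𝔸 X] {b : 𝔸} {t : NameAbs 𝔸 X} (h : Fresh 𝔸 b t)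
    (i : Bool) : ZeroOneSet.sub (conc b t) b i = endpoint i t := by
  obtain ⟨x, rfl⟩ := exists_eq_mk h
  rw [conc_mk, endpoint_mk]

theorem fresh_conc [NominalSet 𝔸 X] {b c : 𝔸} {t : NameAbs 𝔸 X} (h : Fresh 𝔸 b t)
    (hbc : c ≠ b) (hc : Fresh 𝔸 c t) : Fresh 𝔸 c (conc b t) :=
  fresh_of_fresh_mk hbc (by rwa [mk_conc h])

theorem degen_smul [NominalSet 𝔸 X] (π : FinPerm 𝔸) (x : X) :
    degen 𝔸 (π • x) = π • degen 𝔸 x := by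
  obtain ⟨a, -, ha⟩ := exists_fresh (𝔸 := 𝔸) ∅ x
  rw [degen_eq ha, degen_eq (ha.smul π), smul_mk]

theorem degen_sub [ZeroOneSet 𝔸 X] (x : X) (c : 𝔸) (i : Bool) :
    degen 𝔸 (ZeroOneSet.sub x c i) = ZeroOneSet.sub (degen 𝔸 x) c i := by
  obtain ⟨a, hac, ha⟩ := exists_fresh (𝔸 := 𝔸) {c} x
  rw [Finset.mem_singleton] at hac
  rw [degen_eq ha, degen_eq (ha.sub c i)]
  exact (sub_mk hac x i).symm

theorem endpoint_degen [ZeroOneSet 𝔸 X] (i : Bool) (x : X) : endpoint i (degen 𝔸 x) = x := by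
  obtain ⟨a, -, ha⟩ := exists_fresh (𝔸 := 𝔸) ∅ x
  rw [degen_eq ha, endpoint_mk, ZeroOneSet.sub_of_fresh _ _ _ ha]

theorem eq_of_degen_eq_mk [NominalSet 𝔸 X] {b : 𝔸} {x x' : X} (h : degen 𝔸 x = mk b x') :
    x' = x := by
  obtain ⟨a, hab, ha⟩ := exists_fresh (𝔸 := 𝔸) {b} x
  rw [Finset.mem_singleton] at hab
  rw [degen_eq ha] at h
  obtain ⟨hb, rfl⟩ := mk_eq_mk.1 h
  exact swap_smul_of_fresh ha (hb.resolve_left hab)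

/-- If `F` is a support of a group `H` of permutations and `x` is invariant under those elements of
`H` that fix a name `a ∉ F`, then `⟨a⟩x` is invariant under `H`. -/
theorem smul_mk_eq_of_invariant [NominalSet 𝔸 X] {H : Subgroup (FinPerm 𝔸)} {F : Finset 𝔸}
    (hHF : ∀ π ∈ H, ∀ c ∈ F, π • c ∈ F) (hFH : ∀ π : FinPerm 𝔸, (∀ c ∈ F, π • c = c) → π ∈ H)
    {a : 𝔸} (ha : a ∉ F) {x : X} (hx : ∀ π ∈ H, π • a = a → π • x = x) :
    ∀ π ∈ H, π • mk a x = mk a x := by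
  intro π hπ
  by_cases hπa : π • a = a
  · rw [smul_mk, hπa, hx π hπ hπa]
  -- If π moves a, then (a πa) lies in H, since both names avoid F. It fixes ⟨a⟩x because both names
  -- are fresh for it, and (a πa)π fixes a, which reduces to the previous case.
  have ha' : π • a ∉ F := fun h => ha (by simpa using hHF _ (H.inv_mem hπ) _ h)
  have hσ : swap a (π • a) ∈ H := hFH _ fun c hc =>
    Equiv.swap_apply_of_ne_of_ne (fun h => ha (h ▸ hc)) (fun h => ha' (h ▸ hc))
  have hsupp : MulAction.Supports (FinPerm 𝔸) ((insert a F : Finset 𝔸) : Set 𝔸) x := fun τ hτ =>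
    hx τ (hFH τ fun c hc => hτ (by simp [hc])) (hτ (by simp))
  have h1 : swap a (π • a) • mk a x = mk a x := swap_smul_of_fresh (fresh_mk_self a x)
    (fresh_mk_of_fresh hπa (fresh_of_supports hsupp (by simp [hπa, ha'])))
  have h2 : (swap a (π • a) * π) • a = a := by
    rw [mul_smul, swap_smul, Equiv.swap_apply_right]
  have h3 : (swap a (π • a) * π) • mk a x = mk a x := by
    rw [smul_mk, h2, hx _ (H.mul_mem hσ hπ) h2]
  rw [← swap_swap_smul a (π • a) (π • mk a x), ← mul_smul (swap a (π • a)) π, h3, h1]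

end NameAbs

/-! ### Morphisms by induction on supports -/

section Induction

variable {𝔸 : Type u} [DecidableEq 𝔸] [Infinite 𝔸]

/-- The transporters `g` are not equivariant: `g (π • w)` and `π * g w` may differ by an element of
the stabilizer of `rep w`. Hence the stabilizer-invariance demanded in `exists_morphism_of_step`. -/
theorem exists_orbit_representatives (G : Type v) [Group G] (P : Type w) [MulAction G P] :
    ∃ (rep : P → P) (g : P → G), (∀ w, g w • rep w = w) ∧ ∀ (π : G) w, rep (π • w) = rep w := by
  have h : ∀ w : P, ∃ g : G,
      g • (Quotient.mk (MulAction.orbitRel G P) w).out = w := fun w =>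
    MulAction.mem_orbit_iff.1 ((MulAction.orbitRel G P).symm
      (Quotient.mk_out (s := MulAction.orbitRel G P) w))
  choose g hg using h
  refine ⟨fun w => (Quotient.mk (MulAction.orbitRel G P) w).out, g, hg, fun π w => ?_⟩
  exact congrArg Quotient.out (Quotient.sound (s := MulAction.orbitRel G P) ⟨π, rfl⟩)

variable {P : Type v} {T : Type w} [ZeroOneSet 𝔸 P] [ZeroOneSet 𝔸 T]

/-- A morphism `P → T` with values in prescribed sets can be constructed by induction on the size
of supports, extending at each `x : P` from the faces of `x`, provided that the extension can be
chosen invariant under the stabilizer of `x`. -/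
theorem exists_morphism_of_step (Good : P → T → Prop) (dflt : P → T)
    (good_smul : ∀ (π : FinPerm 𝔸) x t, Good x t → Good (π • x) (π • t))
    (step : ∀ (x : P) (ψ : P → T),
      (∀ v, (supp 𝔸 v).card < (supp 𝔸 x).card → Good v (ψ v) ∧
        (∀ π : FinPerm 𝔸, ψ (π • v) = π • ψ v) ∧
        ∀ (c : 𝔸) i, ψ (ZeroOneSet.sub v c i) = ZeroOneSet.sub (ψ v) c i) →
      ∃ t, Good x t ∧ (∀ c ∈ supp 𝔸 x, ∀ i, ZeroOneSet.sub t c i = ψ (ZeroOneSet.sub x c i)) ∧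
        ∀ π : FinPerm 𝔸, π • x = x → π • t = t) :
    ∃ φ : P → T, (∀ (π : FinPerm 𝔸) x, φ (π • x) = π • φ x) ∧
      (∀ x (c : 𝔸) i, φ (ZeroOneSet.sub x c i) = ZeroOneSet.sub (φ x) c i) ∧
      ∀ x, Good x (φ x) := by
  classical
  obtain ⟨rep, g, hg, hrep⟩ := exists_orbit_representatives (FinPerm 𝔸) P
  let rk : P → ℕ := fun v => (supp 𝔸 v).card
  have rk_smul : ∀ (π : FinPerm 𝔸) v, rk (π • v) = rk v := card_supp_smul
  let Sol : P → (P → T) → T → Prop := fun x ψ t =>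
    Good x t ∧ (∀ c ∈ supp 𝔸 x, ∀ i, ZeroOneSet.sub t c i = ψ (ZeroOneSet.sub x c i)) ∧
        ∀ π : FinPerm 𝔸, π • x = x → π • t = t
  let sol : P → (P → T) → T := fun x ψ => if h : ∃ t, Sol x ψ t then h.choose else dflt x
  have sol_spec : ∀ x ψ, (∃ t, Sol x ψ t) → Sol x ψ (sol x ψ) := fun x ψ h => by
    simp only [sol, dif_pos h]
    exact h.choose_spec
  -- Well-founded recursion on the size of the support. The truncation of `φ` depends on `x` only
  -- through `rk x`, so it is the same along an orbit; the values of `dflt` that complete it never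
  -- enter the conditions of `step`.
  obtain ⟨φ, hφ⟩ : ∃ φ : P → T, ∀ x,
      φ x = g x • sol (rep x) (fun v => if rk v < rk x then φ v else dflt v) := by
    let Φ : ∀ x, (∀ v, rk v < rk x → T) → T := fun x ih =>
      g x • sol (rep x) (fun v => if h : rk v < rk x then ih v h else dflt v)
    refine ⟨(measure rk).wf.fix Φ, fun x => ?_⟩
    rw [WellFounded.fix_eq]
    simp only [Φ, dite_eq_ite]
  have main : ∀ n x, rk x = n → Good x (φ x) ∧ (∀ π : FinPerm 𝔸, φ (π • x) = π • φ x) ∧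
        ∀ (c : 𝔸) i, φ (ZeroOneSet.sub x c i) = ZeroOneSet.sub (φ x) c i := by
    intro n
    induction n using Nat.strong_induction_on with
    | _ n ih =>
    rintro x rfl
    set ψ : P → T := fun v => if rk v < rk x then φ v else dflt v with hψ
    have ψ_of : ∀ v, rk v < rk x → ψ v = φ v := fun v hv => if_pos hv
    have rk_rep : rk (rep x) = rk x := by rw [← rk_smul (g x), hg]
    have hsol : Sol (rep x) ψ (sol (rep x) ψ) := by
      refine sol_spec _ _ (step _ _ fun v hv => ?_)
      replace hv : rk v < rk x := rk_rep ▸ hv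
      obtain ⟨h1, h2, h3⟩ := ih _ hv v rfl
      refine ⟨by rwa [ψ_of v hv], fun π => ?_, fun c i => ?_⟩
      · rw [ψ_of _ (by rwa [rk_smul]), ψ_of v hv, h2]
      · rw [ψ_of _ ((card_supp_sub_le v c i).trans_lt hv), ψ_of v hv, h3]
    obtain ⟨h1, h2, h3⟩ := hsol
    have hφx : φ x = g x • sol (rep x) ψ := hφ x
    have hequiv : ∀ π : FinPerm 𝔸, φ (π • x) = π • φ x := by
      intro π
      rw [hφ (π • x), hrep, hφx]
      simp only [rk_smul]
      -- This permutation stabilizes `rep x`, hence fixes the value chosen there.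
      have := h3 ((g (π • x))⁻¹ * π * g x) (by rw [mul_smul, mul_smul, hg, inv_smul_eq_iff,
        ← hrep π x, hg])
      rw [mul_smul, mul_smul, inv_smul_eq_iff] at this
      exact this.symm
    refine ⟨?_, hequiv, fun c i => ?_⟩
    · have := good_smul (g x) _ _ h1
      rwa [hg, ← hφx] at this
    · by_cases hc : c ∈ supp 𝔸 x
      · have hc' : (g x)⁻¹ • c ∈ supp 𝔸 (rep x) := by
          rwa [← smul_mem_supp (g x), smul_inv_smul, hg]
        have hlt := card_supp_sub_lt hc' i
        change rk _ < rk _ at hlt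
        rw [rk_rep] at hlt
        have h4 := h2 _ hc' i
        rw [ψ_of _ hlt] at h4
        have h5 := congrArg (g x • ·) h4
        rw [ZeroOneSet.smul_sub, smul_inv_smul, ← hφx, ← (ih _ hlt _ rfl).2.1,
          ZeroOneSet.smul_sub, smul_inv_smul, hg] at h5
        exact h5.symm
      -- Off the support of `x` nothing was prescribed: equivariance makes `supp 𝔸 x` a support of
      -- `φ x`, so both substitutions are trivial.
      · rw [ZeroOneSet.sub_of_fresh x c i (notMem_supp.1 hc), ZeroOneSet.sub_of_fresh]
        refine fresh_of_supports (F := supp 𝔸 x) (fun π hπ => ?_) hc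
        rw [← hequiv, supports_supp x π hπ]
  exact ⟨φ, fun π x => (main _ x rfl).2.1 π, fun x => (main _ x rfl).2.2,
    fun x => (main _ x rfl).1⟩

end Induction

/-! ### Fillers of boxes with symmetries -/

section Fillers

variable {𝔸 : Type u} [DecidableEq 𝔸] [Infinite 𝔸] {X Y : ZeroOneSub 𝔸} {f : X ⟶ Y} {e : Bool}

/-- The index type of the faces depends on `A` and `a`; comparing them at raw pairs, with both
membership proofs, avoids heterogeneous equality. -/
theorem OpenBox.ext_of_faces {B C : OpenBox f e} (hA : B.A = C.A) (ha : B.a = C.a)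
    (hu : ∀ (p : 𝔸 × Bool) (h : p.1 ∈ B.A ∧ p ≠ (B.a, e)) (h' : p.1 ∈ C.A ∧ p ≠ (C.a, e)),
      B.u ⟨p, h⟩ = C.u ⟨p, h'⟩)
    (hy : B.y = C.y) : B = C := by
  obtain ⟨A, a, _, u, y, _, _, _⟩ := B
  obtain ⟨A', a', _, u', y', _, _, _⟩ := C
  dsimp only at hA ha hy
  subst hA ha hy
  obtain rfl : u = u' := funext fun p => hu p.1 p.2 p.2
  rfl

theorem image_smul_eq_of_invariant {H : Subgroup (FinPerm 𝔸)} {D : Finset 𝔸}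
    (hD : ∀ π ∈ H, ∀ c ∈ D, π • c ∈ D) {π : FinPerm 𝔸} (hπ : π ∈ H) :
    D.image (fun c => π • c) = D := by
  ext c
  rw [Finset.mem_image]
  constructor
  · rintro ⟨b, hb, rfl⟩
    exact hD π hπ b hb
  · exact fun hc => ⟨π⁻¹ • c, hD _ (H.inv_mem hπ) _ hc, smul_inv_smul _ _⟩

/-- An open box that is invariant under a group of permutations has an invariant filler. -/
theorem KanFilling.exists_invariant_filler (K : KanFilling f e) (H : Subgroup (FinPerm 𝔸))
    {D : Finset 𝔸} {a : 𝔸} (ha : a ∈ D) (u : 𝔸 → Bool → X) (y : Y)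
    (hD : ∀ π ∈ H, ∀ c ∈ D, π • c ∈ D) (hHa : ∀ π ∈ H, π • a = a)
    (hu : ∀ π ∈ H, ∀ c ∈ D, ∀ i, (c, i) ≠ (a, e) → u (π • c) i = π • u c i)
    (hy : ∀ π ∈ H, π • y = y)
    (fresh : ∀ c ∈ D, ∀ i, (c, i) ≠ (a, e) → Fresh 𝔸 c (u c i))
    (adj : ∀ c ∈ D, ∀ i, (c, i) ≠ (a, e) → ∀ c' ∈ D, ∀ i', (c', i') ≠ (a, e) → c ≠ c' →
      ZeroOneSet.sub (u c i) c' i' = ZeroOneSet.sub (u c' i') c i)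
    (h_over : ∀ c ∈ D, ∀ i, (c, i) ≠ (a, e) → f (u c i) = ZeroOneSet.sub y c i) :
    ∃ x : X, (∀ c ∈ D, ∀ i, (c, i) ≠ (a, e) → ZeroOneSet.sub x c i = u c i) ∧ f x = y ∧
      ∀ π ∈ H, π • x = x := by
  let B : OpenBox f e :=
    { A := D
      a := a
      mem := ha
      u := fun p => u p.1.1 p.1.2
      y := y
      fresh := fun p => fresh _ p.2.1 _ p.2.2
      adj := fun p q h => adj _ p.2.1 _ p.2.2 _ q.2.1 _ q.2.2 h
      lies_over := fun p => h_over _ p.2.1 _ p.2.2 }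
  refine ⟨K.fill B, fun c hc i hi => (K.isFiller B).1 ⟨(c, i), hc, hi⟩, (K.isFiller B).2,
    fun π hπ => ?_⟩
  -- Since π • fill B = fill (π B), it suffices that the box itself is invariant.
  rw [← K.fill_perm]
  congr 1
  refine OpenBox.ext_of_faces (image_smul_eq_of_invariant hD hπ) (hHa π hπ) (fun p h h' => ?_)
    (hy π hπ)
  have hp := OpenBox.permAux (A := D) (a := a) π ⟨p, h⟩
  have := hu π hπ _ hp.1 _ hp.2
  rw [smul_inv_smul] at this
  exact this.symm

end Fillers

/-! ### The endpoints map is a fibration -/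

section Endpoints

variable {𝔸 : Type u} [DecidableEq 𝔸] [Infinite 𝔸] {X Y : ZeroOneSub 𝔸} {f : X ⟶ Y} {e : Bool}

theorem fresh_val {w : nameAbsOver f} {a : 𝔸} (h : Fresh 𝔸 a w) : Fresh 𝔸 a w.1 :=
  h.map (fun w : nameAbsOver f => w.1) fun _ _ => rfl

/-- Membership in [𝔸]_f X only provides some representative ⟨a⟩x with a # f x; the transposition (c
a) carries this to the representative at c. -/
theorem fresh_map_conc {w : nameAbsOver f} {c : 𝔸} (hc : Fresh 𝔸 c w) :
    Fresh 𝔸 c (f (NameAbs.conc c w.1)) := by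
  obtain ⟨a, x, hax, h⟩ := w.2
  have h' := (NameAbs.mk_conc (fresh_val hc)).trans h
  have hx := (NameAbs.mk_eq_mk.1 h').2
  have := hax.smul (swap c a)
  rwa [swap_smul, Equiv.swap_apply_right, hx, map_smul, swap_swap_smul] at this

/-- A path in [𝔸]_f X lies in a single fibre of f, so it lies over the same element of Y as either
endpoint. -/
theorem map_conc_eq {w : nameAbsOver f} {c : 𝔸} (hc : Fresh 𝔸 c w) (i : Bool) :
    f (NameAbs.conc c w.1) = f (NameAbs.endpoint i w.1) := by
  rw [← NameAbs.sub_conc_self (fresh_val hc), map_sub,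
    ZeroOneSet.sub_of_fresh _ _ _ (fresh_map_conc hc)]

/-- The component of an element of the fibre product at an endpoint. -/
def side (z : fibreProd f) (i : Bool) : X := cond i z.1.2 z.1.1

theorem side_smul (π : FinPerm 𝔸) (z : fibreProd f) (i : Bool) :
    side (π • z) i = π • side z i := by cases i <;> rfl

theorem side_sub (z : fibreProd f) (c : 𝔸) (j i : Bool) :
    side (ZeroOneSet.sub z c j) i = ZeroOneSet.sub (side z i) c j := by cases i <;> rfl

theorem map_side (z : fibreProd f) (i j : Bool) : f (side z i) = f (side z j) := by
  cases i <;> cases j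
  exacts [rfl, z.2, z.2.symm, rfl]

theorem side_endpointsMap (w : nameAbsOver f) (i : Bool) :
    side (endpointsMap f w) i = NameAbs.endpoint i w.1 := by cases i <;> rfl

theorem fibreProd_ext {z z' : fibreProd f} (h : ∀ i, side z i = side z' i) : z = z' :=
  Subtype.ext (Prod.ext (h false) (h true))

namespace OpenBox

/-- The name `c` is fresh for the box `B`. -/
structure FreshFor {Z W : ZeroOneSub 𝔸} {g : Z ⟶ W} (B : OpenBox g e) (c : 𝔸) : Prop where
  notMem : c ∉ B.A
  face : ∀ p, Fresh 𝔸 c (B.u p)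
  base : Fresh 𝔸 c B.y

section

variable {Z W : ZeroOneSub 𝔸} {g : Z ⟶ W}

theorem exists_freshFor (B : OpenBox g e) (F : Finset 𝔸) : ∃ c, c ∉ F ∧ B.FreshFor c := by
  have : Finite (Faces B.A B.a e) := Finite.of_injective
    (fun p => (⟨⟨p.1.1, p.2.1⟩, p.1.2⟩ : B.A × Bool)) (fun p q h => by
      simp only [Prod.mk.injEq, Subtype.mk.injEq] at h
      exact Subtype.ext (Prod.ext h.1 h.2))
  have := Fintype.ofFinite (Faces B.A B.a e)
  obtain ⟨c, hc⟩ := Infinite.exists_notMem_finset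
    (F ∪ B.A ∪ supp 𝔸 B.y ∪ Finset.univ.biUnion fun p => supp 𝔸 (B.u p))
  simp only [Finset.mem_union, Finset.mem_biUnion, Finset.mem_univ, true_and, not_or,
    not_exists, notMem_supp] at hc
  exact ⟨c, hc.1.1.1, hc.1.1.2, hc.2, hc.1.2⟩

theorem FreshFor.perm {B : OpenBox g e} {c : 𝔸} (h : B.FreshFor c) (π : FinPerm 𝔸) :
    (B.perm π).FreshFor (π • c) where
  notMem := by
    change π • c ∉ B.A.image _
    simpa using h.notMem
  face p := (h.face _).smul π
  base := h.base.smul π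

theorem FreshFor.sub {B : OpenBox g e} {c : 𝔸} (h : B.FreshFor c) (d : 𝔸) (i : Bool)
    (hd : d ∉ B.A) : (B.sub d i hd).FreshFor c where
  notMem := h.notMem
  face p := (h.face p).sub d i
  base := h.base.sub d i

theorem perm_swap_of_freshFor {B : OpenBox g e} {c d : 𝔸} (hc : B.FreshFor c)
    (hd : B.FreshFor d) : B.perm (swap c d) = B := by
  have hfix : ∀ b ∈ B.A, swap c d • b = b := fun b hb =>
    Equiv.swap_apply_of_ne_of_ne (fun h => hc.notMem (h ▸ hb)) (fun h => hd.notMem (h ▸ hb))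
  have hinv : ∀ b ∈ B.A, (swap c d)⁻¹ • b = b := fun b hb => by
    rw [inv_smul_eq_iff, hfix b hb]
  refine ext_of_faces ?_ (hfix _ B.mem) (fun p h h' => ?_) (swap_smul_of_fresh hc.base hd.base)
  · exact (Finset.image_congr (g := id) hfix).trans Finset.image_id
  · have : B.u ⟨((swap c d)⁻¹ • p.1, p.2), permAux _ ⟨p, h⟩⟩ = B.u ⟨p, h'⟩ := by
      congr 2
      exact Prod.ext (hinv _ h'.1) rfl
    change swap c d • B.u _ = _
    rw [this]
    exact swap_smul_of_fresh (hc.face _) (hd.face _)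

/-- Substituting for c leaves the box unchanged, so by uniformity it leaves the filler unchanged. -/
theorem FreshFor.fresh_fill {B : OpenBox g e} {c : 𝔸} (h : B.FreshFor c) (K : KanFilling g e) :
    Fresh 𝔸 c (K.fill B) := by
  refine fresh_of_sub_eq (i := false) ?_
  rw [← K.fill_sub B c false h.notMem]
  congr 1
  exact ext_of_faces rfl rfl (fun p _ _ => ZeroOneSet.sub_of_fresh _ _ _ (h.face _))
    (ZeroOneSet.sub_of_fresh _ _ _ h.base)

end

theorem endpoint_face (B : OpenBox (endpointsMap f) e) (p : Faces B.A B.a e) (i : Bool) :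
    NameAbs.endpoint i (B.u p).1 = ZeroOneSet.sub (side B.y i) p.1.1 p.1.2 := by
  rw [← side_endpointsMap, B.lies_over, side_sub]

theorem mem_faces_of_ne {A : Finset 𝔸} {a c : 𝔸} {p : 𝔸 × Bool}
    (hp : p.1 ∈ insert c A ∧ p ≠ (a, e)) (h : p.1 ≠ c) : p.1 ∈ A ∧ p ≠ (a, e) :=
  ⟨(Finset.mem_insert.1 hp.1).resolve_left h, hp.2⟩

/-- The faces of the transpose of an open box over `endpointsMap f`. -/
noncomputable def transposeFace (B : OpenBox (endpointsMap f) e) (c : 𝔸)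
    (p : Faces (insert c B.A) B.a e) : X :=
  if h : p.1.1 = c then side B.y p.1.2 else NameAbs.conc c (B.u ⟨p.1, mem_faces_of_ne p.2 h⟩).1

theorem transposeFace_self {B : OpenBox (endpointsMap f) e} {c : 𝔸}
    {p : Faces (insert c B.A) B.a e} (h : p.1.1 = c) : B.transposeFace c p = side B.y p.1.2 :=
  dif_pos h

theorem transposeFace_of_ne {B : OpenBox (endpointsMap f) e} {c : 𝔸}
    {p : Faces (insert c B.A) B.a e} (h : p.1.1 ≠ c) :
    B.transposeFace c p = NameAbs.conc c (B.u ⟨p.1, mem_faces_of_ne p.2 h⟩).1 :=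
  dif_neg h

theorem FreshFor.side {B : OpenBox (endpointsMap f) e} {c : 𝔸} (hc : B.FreshFor c) (i : Bool) :
    Fresh 𝔸 c (side B.y i) :=
  hc.base.map (fun z : fibreProd f => NomCube.side z i) fun _ _ => side_smul _ _ _

/-- Adjacency of a c-face with any other face of the transpose is precisely the condition that the
original box lies over its base. -/
theorem sub_transposeFace_self {B : OpenBox (endpointsMap f) e} {c : 𝔸} (hc : B.FreshFor c)
    {p : Faces (insert c B.A) B.a e} (h : p.1.1 ≠ c) (i : Bool) :
    ZeroOneSet.sub (B.transposeFace c p) c i =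
      ZeroOneSet.sub (NomCube.side B.y i) p.1.1 p.1.2 := by
  rw [transposeFace_of_ne h, NameAbs.sub_conc_self (fresh_val (hc.face _)), endpoint_face]

/-- The open box over `f`, with the additional direction `c`, obtained from an open box over
`endpointsMap f` by concretion at `c`. -/
noncomputable def transpose (B : OpenBox (endpointsMap f) e) {c : 𝔸} (hc : B.FreshFor c) :
    OpenBox f e where
  A := insert c B.A
  a := B.a
  mem := Finset.mem_insert_of_mem B.mem
  u := B.transposeFace c
  -- The other component would do equally well, by `map_side`.
  y := f (side B.y false)
  fresh p := by
    by_cases h : p.1.1 = c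
    · rw [transposeFace_self h, h]
      exact hc.side _
    · rw [transposeFace_of_ne h]
      exact NameAbs.fresh_conc (fresh_val (hc.face _)) h (fresh_val (B.fresh ⟨p.1, _⟩))
  adj p q hpq := by
    by_cases hp : p.1.1 = c
    · have hq : q.1.1 ≠ c := fun h => hpq (hp.trans h.symm)
      rw [transposeFace_self hp, hp, sub_transposeFace_self hc hq]
    · by_cases hq : q.1.1 = c
      · rw [transposeFace_self hq, hq, sub_transposeFace_self hc hp]
      · rw [transposeFace_of_ne hp, transposeFace_of_ne hq,
          NameAbs.sub_conc (fresh_val (hc.face _)) (Ne.symm hq),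
          NameAbs.sub_conc (fresh_val (hc.face _)) (Ne.symm hp)]
        exact congrArg (fun w : nameAbsOver f => NameAbs.conc c w.1)
          (B.adj ⟨p.1, mem_faces_of_ne p.2 hp⟩ ⟨q.1, mem_faces_of_ne q.2 hq⟩ hpq)
  lies_over p := by
    by_cases h : p.1.1 = c
    · rw [transposeFace_self h, h, ZeroOneSet.sub_of_fresh _ _ _
        ((hc.side false).map f (map_smul f)), map_side]
    · rw [transposeFace_of_ne h, map_conc_eq (hc.face _) false, endpoint_face, map_sub]

theorem transpose_perm (B : OpenBox (endpointsMap f) e) {c : 𝔸} (hc : B.FreshFor c)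
    (π : FinPerm 𝔸) : (B.perm π).transpose (hc.perm π) = (B.transpose hc).perm π := by
  refine ext_of_faces (Finset.image_insert _ _ _).symm rfl (fun p h h' => ?_) ?_
  · change (B.perm π).transposeFace (π • c) ⟨p, h⟩ = π • B.transposeFace c ⟨(π⁻¹ • p.1, p.2), _⟩
    by_cases hp : p.1 = π • c
    · rw [transposeFace_self hp, transposeFace_self (by
        change π⁻¹ • p.1 = c
        rw [hp, inv_smul_smul]), ← side_smul]
      rfl
    · rw [transposeFace_of_ne hp, transposeFace_of_ne (fun h => hp (inv_smul_eq_iff.1 h)),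
        NameAbs.smul_conc (fresh_val (hc.face _))]
      rfl
  · change f (side (π • B.y) false) = π • f (side B.y false)
    rw [side_smul, map_smul]

theorem transpose_sub (B : OpenBox (endpointsMap f) e) {c : 𝔸} (hc : B.FreshFor c) {d : 𝔸}
    (i : Bool) (hd : d ∉ B.A) (hcd : c ≠ d) :
    (B.sub d i hd).transpose (hc.sub d i hd) =
      (B.transpose hc).sub d i (by
        change d ∉ insert c B.A
        simp [hd, Ne.symm hcd]) := by
  refine ext_of_faces rfl rfl (fun p h h' => ?_) ?_
  · change (B.sub d i hd).transposeFace c ⟨p, h⟩ = ZeroOneSet.sub (B.transposeFace c ⟨p, h'⟩) d i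
    by_cases hp : p.1 = c
    · rw [transposeFace_self hp, transposeFace_self hp, ← side_sub]
      rfl
    · rw [transposeFace_of_ne hp, transposeFace_of_ne hp,
        NameAbs.sub_conc (fresh_val (hc.face _)) hcd]
      rfl
  · change f (side (ZeroOneSet.sub B.y d i) false) = ZeroOneSet.sub (f (side B.y false)) d i
    rw [side_sub, map_sub]

/-- Independence of the auxiliary name: d is fresh for the transpose at c, hence for its filler, and
(c d) takes this transpose to the one at d because it fixes the original box. -/
theorem mk_fill_transpose_eq (K : KanFilling f e) {B C : OpenBox (endpointsMap f) e} (h : B = C)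
    {c d : 𝔸} (hc : B.FreshFor c) (hd : C.FreshFor d) :
    NameAbs.mk c (K.fill (B.transpose hc)) = NameAbs.mk d (K.fill (C.transpose hd)) := by
  subst h
  by_cases hcd : c = d
  · subst hcd; rfl
  have hfr : (B.transpose hc).FreshFor d :=
    { notMem := by
        change d ∉ insert c B.A
        simp [hd.notMem, Ne.symm hcd]
      face := fun p => by
        change Fresh 𝔸 d (B.transposeFace c p)
        by_cases hp : p.1.1 = c
        · rw [transposeFace_self hp]
          exact hd.side _
        · rw [transposeFace_of_ne hp]
          exact NameAbs.fresh_conc (fresh_val (hc.face _)) (Ne.symm hcd) (fresh_val (hd.face _))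
      base := (hd.side false).map f (map_smul f) }
  refine NameAbs.mk_eq_mk.2 ⟨Or.inr (hfr.fresh_fill K), ?_⟩
  rw [← K.fill_perm, ← transpose_perm]
  congr 1
  -- The box, the name and the freshness proof depend on one another and have to be replaced
  -- simultaneously.
  have key : ∀ {C : OpenBox (endpointsMap f) e} (_ : B = C) {b : 𝔸} (_ : d = b)
      (hb : C.FreshFor b), B.transpose hd = C.transpose hb := by
    rintro _ rfl _ rfl _
    rfl
  exact key (perm_swap_of_freshFor hc hd).symm (Equiv.swap_apply_left c d).symm _

/-- The filler of an open box over `endpointsMap f`. -/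
noncomputable def transposeFill (K : KanFilling f e) (B : OpenBox (endpointsMap f) e) :
    nameAbsOver f :=
  ⟨NameAbs.mk (B.exists_freshFor ∅).choose
      (K.fill (B.transpose (B.exists_freshFor ∅).choose_spec.2)), _, _, by
    rw [(K.isFiller _).2]
    exact ((B.exists_freshFor ∅).choose_spec.2.side false).map f (map_smul f), rfl⟩

theorem transposeFill_val (K : KanFilling f e) (B : OpenBox (endpointsMap f) e) {c : 𝔸}
    (hc : B.FreshFor c) : (transposeFill K B).1 = NameAbs.mk c (K.fill (B.transpose hc)) :=
  mk_fill_transpose_eq K rfl _ _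

end OpenBox

/-- A Kan filling operator for `endpointsMap f`. -/
noncomputable def KanFilling.endpointsMap (K : KanFilling f e) :
    KanFilling (endpointsMap f) e where
  fill := OpenBox.transposeFill K
  isFiller B := by
    obtain ⟨c, -, hc⟩ := B.exists_freshFor ∅
    have hK := K.isFiller (B.transpose hc)
    refine ⟨fun p => Subtype.ext ?_, fibreProd_ext fun i => ?_⟩
    · have hpc : c ≠ p.1.1 := fun h => hc.notMem (h ▸ p.2.1)
      change NameAbs.sub (OpenBox.transposeFill K B).1 p.1.1 p.1.2 = _
      rw [OpenBox.transposeFill_val K B hc, NameAbs.sub_mk hpc,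
        hK.1 ⟨p.1, Finset.mem_insert_of_mem p.2.1, p.2.2⟩]
      change NameAbs.mk c (B.transposeFace c ⟨p.1, Finset.mem_insert_of_mem p.2.1, p.2.2⟩) = _
      rw [OpenBox.transposeFace_of_ne (c := c) (p := ⟨p.1, _⟩) (Ne.symm hpc), NameAbs.mk_conc (fresh_val (hc.face _))]
    · rw [side_endpointsMap, OpenBox.transposeFill_val K B hc, NameAbs.endpoint_mk,
        hK.1 ⟨(c, i), Finset.mem_insert_self _ _, fun h => hc.notMem
          (by rw [(Prod.mk.inj h).1]; exact B.mem)⟩]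
      exact OpenBox.transposeFace_self rfl
  fill_perm π B := Subtype.ext (by
    obtain ⟨c, -, hc⟩ := B.exists_freshFor ∅
    change _ = π • (OpenBox.transposeFill K B).1
    rw [OpenBox.transposeFill_val K B hc, OpenBox.transposeFill_val K _ (hc.perm π),
      OpenBox.transpose_perm, K.fill_perm, NameAbs.smul_mk])
  fill_sub B d i hd := Subtype.ext (by
    -- Choosing c different from d lets the substitution pass under the abstraction and keeps d
    -- outside the enlarged set of directions.
    obtain ⟨c, hcd, hc⟩ := B.exists_freshFor {d}
    rw [Finset.mem_singleton] at hcd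
    change _ = NameAbs.sub (OpenBox.transposeFill K B).1 d i
    rw [OpenBox.transposeFill_val K B hc, OpenBox.transposeFill_val K _ (hc.sub d i hd),
      OpenBox.transpose_sub B hc i hd hcd, K.fill_sub, NameAbs.sub_mk hcd])

theorem kanFibrations_endpointsMap (hf : kanFibrations 𝔸 f) :
    kanFibrations 𝔸 (endpointsMap f) :=
  ⟨hf.1.map KanFilling.endpointsMap, hf.2.map KanFilling.endpointsMap⟩

end Endpoints
/-! ### The reflexivity map is a left map -/

section Reflexivity

variable {𝔸 : Type u} [DecidableEq 𝔸] [Infinite 𝔸] {X Y Z W : ZeroOneSub 𝔸} {f : X ⟶ Y}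

variable (f) in
/-- The source map `[𝔸]_f X ⟶ X`, `⟨a⟩x ↦ x(a := 0)`. -/
def sourceMap : nameAbsOver f ⟶ X := endpointsMap f ≫ fibreFst f

theorem sourceMap_apply (w : nameAbsOver f) : sourceMap f w = NameAbs.endpoint false w.1 := rfl

theorem sourceMap_reflMap (x : X) : sourceMap f (reflMap f x) = x :=
  NameAbs.endpoint_degen false x

theorem reflMap_injective : Function.Injective (reflMap f) :=
  Function.LeftInverse.injective sourceMap_reflMap

/-- Given a support `F` of a group `H` of permutations, an `H`-invariant boundary in `[𝔸]_f X` with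
directions `F`, lying over an `H`-invariant element along the source map, has an `H`-invariant
filler. -/
theorem KanFilling.exists_boundary_filler (K : KanFilling f true) {H : Subgroup (FinPerm 𝔸)}
    {F : Finset 𝔸} (hHF : ∀ π ∈ H, ∀ c ∈ F, π • c ∈ F)
    (hFH : ∀ π : FinPerm 𝔸, (∀ c ∈ F, π • c = c) → π ∈ H)
    (u : 𝔸 → Bool → nameAbsOver f) (x₀ : X)
    (hu : ∀ π ∈ H, ∀ c ∈ F, ∀ i, u (π • c) i = π • u c i)
    (hx₀ : ∀ π ∈ H, π • x₀ = x₀)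
    (fresh : ∀ c ∈ F, ∀ i, Fresh 𝔸 c (u c i))
    (adj : ∀ c ∈ F, ∀ i, ∀ c' ∈ F, ∀ i', c ≠ c' →
      ZeroOneSet.sub (u c i) c' i' = ZeroOneSet.sub (u c' i') c i)
    (source : ∀ c ∈ F, ∀ i, sourceMap f (u c i) = ZeroOneSet.sub x₀ c i) :
    ∃ w : nameAbsOver f, (∀ c ∈ F, ∀ i, ZeroOneSet.sub w c i = u c i) ∧ sourceMap f w = x₀ ∧
      ∀ π ∈ H, π • w = w := by
  obtain ⟨a, ha⟩ := Infinite.exists_notMem_finset F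
  have hne : ∀ c ∈ F, c ≠ a := fun c hc h => ha (h ▸ hc)
  have hax : Fresh 𝔸 a x₀ := fresh_of_supports (F := F) (fun π hπ => hx₀ π (hFH π hπ)) ha
  have hau : ∀ c ∈ F, ∀ i, Fresh 𝔸 a (u c i) := fun c hc i =>
    fresh_of_supports (F := F) (fun π hπ => by
      rw [← hu π (hFH π hπ) c hc, hπ hc]) ha
  -- The path direction a becomes the open direction: x₀ is the face at a = 0, the face at a = 1 is
  -- missing, and the base is f x₀. Invariance of this box is needed only for permutations in H
  -- fixing a; abstracting a restores invariance under all of H.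
  let H' : Subgroup (FinPerm 𝔸) := H ⊓ MulAction.stabilizer (FinPerm 𝔸) a
  let v : 𝔸 → Bool → X := fun c i => if c = a then x₀ else NameAbs.conc a (u c i).1
  have v_a : ∀ i, v a i = x₀ := fun i => if_pos rfl
  have v_of : ∀ c ∈ F, ∀ i, v c i = NameAbs.conc a (u c i).1 := fun c hc i => if_neg (hne c hc)
  have bdry : ∀ c ∈ F, ∀ i, ZeroOneSet.sub (v c i) a false = ZeroOneSet.sub x₀ c i :=
    fun c hc i => by
      rw [v_of c hc, NameAbs.sub_conc_self (fresh_val (hau c hc i)), ← source c hc i,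
        sourceMap_apply]
  have face_a : ∀ i, (a, i) ≠ (a, true) → i = false := fun i hi => by
    cases i
    · rfl
    · exact absurd rfl hi
  obtain ⟨ξ, hξ, hfξ, hHξ⟩ := K.exists_invariant_filler H' (D := insert a F) (a := a)
    (Finset.mem_insert_self a F) v (f x₀)
    (fun π hπ c hc => by
      rcases Finset.mem_insert.1 hc with rfl | hc
      · rw [hπ.2]
        exact Finset.mem_insert_self _ _
      · exact Finset.mem_insert_of_mem (hHF π hπ.1 c hc))
    (fun π hπ => hπ.2)
    (fun π hπ c hc i _ => by
      have hπa : π • a = a := hπ.2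
      rcases Finset.mem_insert.1 hc with rfl | hc
      · rw [hπa, v_a, hx₀ π hπ.1]
      · rw [v_of _ (hHF π hπ.1 c hc), v_of c hc, hu π hπ.1 c hc,
          NameAbs.smul_conc (fresh_val (hau c hc i)), hπa]
        rfl)
    (fun π hπ => by rw [← map_smul, hx₀ π hπ.1])
    (fun c hc i _ => by
      rcases Finset.mem_insert.1 hc with rfl | hc
      · rwa [v_a]
      · rw [v_of c hc]
        exact NameAbs.fresh_conc (fresh_val (hau c hc i)) (hne c hc) (fresh_val (fresh c hc i)))
    (fun c hc i hi c' hc' i' hi' hcc' => by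
      rcases Finset.mem_insert.1 hc with rfl | hc
      · have hc' := (Finset.mem_insert.1 hc').resolve_left (Ne.symm hcc')
        rw [face_a i hi, bdry c' hc', v_a]
      · rcases Finset.mem_insert.1 hc' with rfl | hc'
        · rw [face_a i' hi', bdry c ((Finset.mem_insert.1 hc).resolve_left hcc'), v_a]
        · rw [v_of c hc, v_of c' hc', NameAbs.sub_conc (fresh_val (hau c hc i))
            (Ne.symm (hne c' hc')), NameAbs.sub_conc (fresh_val (hau c' hc' i'))
            (Ne.symm (hne c hc))]
          exact congrArg (fun w : nameAbsOver f => NameAbs.conc a w.1)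
            (adj c hc i c' hc' i' hcc'))
    (fun c hc i _ => by
      rcases Finset.mem_insert.1 hc with rfl | hc
      · rw [v_a, ← map_sub, ZeroOneSet.sub_of_fresh _ _ _ hax]
      · rw [v_of c hc, map_conc_eq (hau c hc i) false, ← sourceMap_apply, source c hc, map_sub])
  refine ⟨⟨NameAbs.mk a ξ, a, ξ, by rw [hfξ]; exact hax.map f (map_smul f), rfl⟩,
    fun c hc i => Subtype.ext ?_, ?_, fun π hπ => Subtype.ext ?_⟩
  · change NameAbs.sub (NameAbs.mk a ξ) c i = _
    rw [NameAbs.sub_mk (Ne.symm (hne c hc)), hξ c (Finset.mem_insert_of_mem hc) i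
      (fun h => hne c hc (Prod.mk.inj h).1), v_of c hc, NameAbs.mk_conc (fresh_val (hau c hc i))]
  · exact (hξ a (Finset.mem_insert_self a F) false (by simp)).trans (v_a false)
  · exact NameAbs.smul_mk_eq_of_invariant hHF hFH ha (fun τ hτ hτa => hHξ τ ⟨hτ, hτa⟩) π hπ

/-- The property of a path `t` in `[𝔸]_f X × Z` of being a path from `(r x₀, k x₀)` to some
`(w, z)`, where `x₀` is the source of `w`, constant if `w` is in the image of `r`, whose first
component has the constant source `x₀` and whose components agree in `W`. -/
structure IsContraction (k : X ⟶ Z) (g : Z ⟶ W) (h : nameAbsOver f ⟶ W) (w : nameAbsOver f)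
    (t : NameAbs 𝔸 (nameAbsOver f × Z)) : Prop where
  start : NameAbs.endpoint false t = (reflMap f (sourceMap f w), k (sourceMap f w))
  finish : (NameAbs.endpoint true t).1 = w
  source : ∀ b q, t = NameAbs.mk b q → sourceMap f q.1 = sourceMap f w
  base : ∀ b q, t = NameAbs.mk b q → h q.1 = g q.2
  refl : ∀ x, w = reflMap f x → t = NameAbs.degen 𝔸 (reflMap f x, k x)

theorem IsContraction.smul {k : X ⟶ Z} {g : Z ⟶ W} {h : nameAbsOver f ⟶ W} {w : nameAbsOver f}
    {t : NameAbs 𝔸 (nameAbsOver f × Z)} (ht : IsContraction k g h w t) (π : FinPerm 𝔸) :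
    IsContraction k g h (π • w) (π • t) where
  start := by
    rw [NameAbs.endpoint_smul, ht.start, map_smul, map_smul, map_smul]
    rfl
  finish := by
    rw [NameAbs.endpoint_smul]
    exact congrArg (π • ·) ht.finish
  source b q hq := by
    have := ht.source (π⁻¹ • b) (π⁻¹ • q) (by rw [← NameAbs.smul_mk, ← hq, inv_smul_smul])
    change sourceMap f (π⁻¹ • q.1) = _ at this
    rw [map_smul, inv_smul_eq_iff] at this
    rw [this, map_smul]
  base b q hq := by
    have := ht.base (π⁻¹ • b) (π⁻¹ • q) (by rw [← NameAbs.smul_mk, ← hq, inv_smul_smul])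
    change h (π⁻¹ • q.1) = g (π⁻¹ • q.2) at this
    rw [map_smul, map_smul] at this
    exact smul_left_cancel _ this
  refl x hx := by
    have hx' : w = reflMap f (π⁻¹ • x) := by
      rw [map_smul, ← hx, inv_smul_smul]
    rw [ht.refl _ hx', ← NameAbs.degen_smul]
    change NameAbs.degen 𝔸 (π • reflMap f (π⁻¹ • x), π • k (π⁻¹ • x)) = _
    rw [← map_smul, ← map_smul, smul_inv_smul]

theorem isContraction_reflMap {k : X ⟶ Z} {g : Z ⟶ W} {h : nameAbsOver f ⟶ W}
    (sq : ∀ x, h (reflMap f x) = g (k x)) (x : X) :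
    IsContraction k g h (reflMap f x) (NameAbs.degen 𝔸 (reflMap f x, k x)) where
  start := by rw [NameAbs.endpoint_degen, sourceMap_reflMap]
  finish := by rw [NameAbs.endpoint_degen]
  source b q hq := by rw [NameAbs.eq_of_degen_eq_mk hq]
  base b q hq := by rw [NameAbs.eq_of_degen_eq_mk hq]; exact sq x
  refl x' hx' := by rw [reflMap_injective hx']

/-- A property of `⟨b⟩q` that is read off from `q` by an equivariant function, at one representative
with `b` fresh for the value, holds at every representative. -/
theorem eq_of_mk_eq_mk {Q : Type v} {V : Type w} [NominalSet 𝔸 Q] [NominalSet 𝔸 V] (s : Q → V)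
    (hs : ∀ (π : FinPerm 𝔸) q, s (π • q) = π • s q) {b b' : 𝔸} {q q' : Q}
    (h : NameAbs.mk b q = NameAbs.mk b' q') (hb : Fresh 𝔸 b (s q)) : s q' = s q := by
  obtain ⟨hb', rfl⟩ := NameAbs.mk_eq_mk.1 h
  rw [hs]
  rcases hb' with rfl | hb'
  · exact swap_self_smul _ _
  · exact swap_smul_of_fresh hb (hb'.map s hs)

/-- The inductive step. Unless w is a constant path, two fillings in the directions supp w ∪ {b}
produce the components of the contraction, where b is its path variable. The first fills a full
boundary in [𝔸]_f X, whose own path variable supplies the open direction; the second fills a box in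
Z over the image of the first, open at b = 1. -/
theorem exists_isContraction (K : KanFilling f true) {k : X ⟶ Z} {g : Z ⟶ W}
    {h : nameAbsOver f ⟶ W} (G : KanFilling g true) (sq : ∀ x, h (reflMap f x) = g (k x))
    (w : nameAbsOver f) (ψ : nameAbsOver f → NameAbs 𝔸 (nameAbsOver f × Z))
    (hψ : ∀ v, (supp 𝔸 v).card < (supp 𝔸 w).card → IsContraction k g h v (ψ v) ∧
        (∀ π : FinPerm 𝔸, ψ (π • v) = π • ψ v) ∧
        ∀ (c : 𝔸) i, ψ (ZeroOneSet.sub v c i) = ZeroOneSet.sub (ψ v) c i) :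
    ∃ t, IsContraction k g h w t ∧
      (∀ c ∈ supp 𝔸 w, ∀ i, ZeroOneSet.sub t c i = ψ (ZeroOneSet.sub w c i)) ∧
      ∀ π : FinPerm 𝔸, π • w = w → π • t = t := by
  -- Faces of a constant path are constant, so the constant contraction agrees with the values
  -- already fixed by `refl` on them.
  by_cases hw : ∃ x, w = reflMap f x
  · obtain ⟨x, rfl⟩ := hw
    refine ⟨_, isContraction_reflMap sq x, fun c hc i => ?_, fun π hπ => ?_⟩
    · rw [(hψ _ (card_supp_sub_lt hc i)).1.refl (ZeroOneSet.sub x c i) (map_sub _ _ _ _).symm,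
        ← NameAbs.degen_sub, map_sub, map_sub]
      rfl
    · rw [← map_smul] at hπ
      rw [← NameAbs.degen_smul]
      change NameAbs.degen 𝔸 (π • reflMap f x, π • k x) = _
      rw [← map_smul, ← map_smul, reflMap_injective hπ]
  set F := supp 𝔸 w
  set x₀ := sourceMap f w with hx₀
  let H : Subgroup (FinPerm 𝔸) := MulAction.stabilizer (FinPerm 𝔸) w
  have hHF : ∀ π ∈ H, ∀ c ∈ F, π • c ∈ F := fun π hπ c hc => by
    have := (smul_mem_supp π).2 hc
    rwa [show π • w = w from hπ] at this
  have hFH : ∀ π : FinPerm 𝔸, (∀ c ∈ F, π • c = c) → π ∈ H := fun π hπ =>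
    supports_supp w π fun c hc => hπ c hc
  obtain ⟨b, hb⟩ := Infinite.exists_notMem_finset F
  have hbw : Fresh 𝔸 b w := notMem_supp.1 hb
  have hbx : Fresh 𝔸 b x₀ := hbw.map _ (map_smul (sourceMap f))
  have hne : ∀ c ∈ F, c ≠ b := fun c hc h => hb (h ▸ hc)
  let H' : Subgroup (FinPerm 𝔸) := H ⊓ MulAction.stabilizer (FinPerm 𝔸) b
  have hHF' : ∀ π ∈ H', ∀ c ∈ insert b F, π • c ∈ insert b F := fun π hπ c hc => by
    rcases Finset.mem_insert.1 hc with rfl | hc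
    · rw [hπ.2]
      exact Finset.mem_insert_self _ _
    · exact Finset.mem_insert_of_mem (hHF π hπ.1 c hc)
  have hFH' : ∀ π : FinPerm 𝔸, (∀ c ∈ insert b F, π • c = c) → π ∈ H' := fun π hπ =>
    ⟨hFH π fun c hc => hπ c (Finset.mem_insert_of_mem hc), hπ b (Finset.mem_insert_self _ _)⟩
  have hHx₀ : ∀ π ∈ H, π • x₀ = x₀ := fun π hπ => by
    rw [hx₀, ← map_smul, show π • w = w from hπ]
  -- the faces of the path to be constructed
  let t' : 𝔸 → Bool → nameAbsOver f × Z := fun c i => NameAbs.conc b (ψ (ZeroOneSet.sub w c i))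
  have low : ∀ c ∈ F, ∀ i, (supp 𝔸 (ZeroOneSet.sub w c i)).card < (supp 𝔸 w).card :=
    fun c hc i => card_supp_sub_lt hc i
  have ψ_fresh : ∀ c ∈ F, ∀ i d, Fresh 𝔸 d (ZeroOneSet.sub w c i) →
      Fresh 𝔸 d (ψ (ZeroOneSet.sub w c i)) := fun c hc i d hd => by
    refine fresh_of_sub_eq (i := false) ?_
    rw [← (hψ _ (low c hc i)).2.2, ZeroOneSet.sub_of_fresh _ _ _ hd]
  have ψ_b : ∀ c ∈ F, ∀ i, Fresh 𝔸 b (ψ (ZeroOneSet.sub w c i)) := fun c hc i =>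
    ψ_fresh c hc i b (hbw.sub c i)
  have t'_mk : ∀ c ∈ F, ∀ i, ψ (ZeroOneSet.sub w c i) = NameAbs.mk b (t' c i) := fun c hc i =>
    (NameAbs.mk_conc (ψ_b c hc i)).symm
  have t'_smul : ∀ π ∈ H', ∀ c ∈ F, ∀ i, t' (π • c) i = π • t' c i := fun π hπ c hc i => by
    have hπw : π • w = w := hπ.1
    have hπb : π • b = b := hπ.2
    rw [NameAbs.smul_conc (ψ_b c hc i), hπb, ← (hψ _ (low c hc i)).2.1, ZeroOneSet.smul_sub, hπw]
  have t'_fresh : ∀ c ∈ F, ∀ i, Fresh 𝔸 c (t' c i) := fun c hc i =>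
    NameAbs.fresh_conc (ψ_b c hc i) (hne c hc) (ψ_fresh c hc i c (ZeroOneSet.fresh_sub _ _ _))
  have t'_adj : ∀ c ∈ F, ∀ i, ∀ c' ∈ F, ∀ i', c ≠ c' →
      ZeroOneSet.sub (t' c i) c' i' = ZeroOneSet.sub (t' c' i') c i :=
    fun c hc i c' hc' i' hcc' => by
      rw [NameAbs.sub_conc (ψ_b c hc i) (Ne.symm (hne c' hc')),
        NameAbs.sub_conc (ψ_b c' hc' i') (Ne.symm (hne c hc)), ← (hψ _ (low c hc i)).2.2,
        ← (hψ _ (low c' hc' i')).2.2, ZeroOneSet.sub_comm _ _ _ _ _ hcc']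
  have t'_start : ∀ c ∈ F, ∀ i, ZeroOneSet.sub (t' c i) b false =
      (ZeroOneSet.sub (reflMap f x₀) c i, ZeroOneSet.sub (k x₀) c i) := fun c hc i => by
    rw [NameAbs.sub_conc_self (ψ_b c hc i), (hψ _ (low c hc i)).1.start, map_sub, map_sub, map_sub]
  have t'_finish : ∀ c ∈ F, ∀ i, ZeroOneSet.sub (t' c i).1 b true = ZeroOneSet.sub w c i :=
    fun c hc i => by
      have := NameAbs.sub_conc_self (ψ_b c hc i) true
      exact (congrArg Prod.fst this).trans (hψ _ (low c hc i)).1.finish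
  -- the component in `[𝔸]_f X`
  let u : 𝔸 → Bool → nameAbsOver f := fun c i =>
    if c = b then cond i w (reflMap f x₀) else (t' c i).1
  have u_b : ∀ i, u b i = cond i w (reflMap f x₀) := fun i => if_pos rfl
  have u_of : ∀ c ∈ F, ∀ i, u c i = (t' c i).1 := fun c hc i => if_neg (hne c hc)
  have u_bdry : ∀ c ∈ F, ∀ i i', ZeroOneSet.sub (u c i) b i' = ZeroOneSet.sub (u b i') c i :=
    fun c hc i i' => by
      rw [u_of c hc, u_b]
      cases i'
      · exact congrArg Prod.fst (t'_start c hc i)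
      · exact t'_finish c hc i
  obtain ⟨q, hq, hqx, hqH⟩ := K.exists_boundary_filler hHF' hFH' u x₀
    (fun π hπ c hc i => by
      have hπw : π • w = w := hπ.1
      have hπb : π • b = b := hπ.2
      rcases Finset.mem_insert.1 hc with rfl | hc
      · rw [hπb, u_b]
        cases i
        · exact (by rw [← map_smul, hHx₀ π hπ.1] :
            reflMap f x₀ = π • reflMap f x₀)
        · exact hπw.symm
      · rw [u_of _ (hHF π hπ.1 c hc), u_of c hc, t'_smul π hπ c hc]
        rfl)
    (fun π hπ => hHx₀ π hπ.1)
    (fun c hc i => by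
      rcases Finset.mem_insert.1 hc with rfl | hc
      · rw [u_b]
        cases i
        · exact hbx.map _ (map_smul (reflMap f))
        · exact hbw
      · rw [u_of c hc]
        exact (t'_fresh c hc i).map Prod.fst fun _ _ => rfl)
    (fun c hc i c' hc' i' hcc' => by
      rcases Finset.mem_insert.1 hc with rfl | hc
      · exact (u_bdry c' ((Finset.mem_insert.1 hc').resolve_left (Ne.symm hcc')) i' i).symm
      · rcases Finset.mem_insert.1 hc' with rfl | hc'
        · exact u_bdry c ((Finset.mem_insert.1 hc).resolve_left hcc') i i'
        · rw [u_of c hc, u_of c' hc']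
          exact congrArg Prod.fst (t'_adj c hc i c' hc' i' hcc'))
    (fun c hc i => by
      rcases Finset.mem_insert.1 hc with rfl | hc
      · rw [u_b, ZeroOneSet.sub_of_fresh _ _ _ hbx]
        cases i
        · exact sourceMap_reflMap x₀
        · rfl
      · rw [u_of c hc, (hψ _ (low c hc i)).1.source b _ (t'_mk c hc i), map_sub])
  -- the component in `Z`
  let z' : 𝔸 → Bool → Z := fun c i => if c = b then k x₀ else (t' c i).2
  have z'_b : ∀ i, z' b i = k x₀ := fun i => if_pos rfl
  have z'_of : ∀ c ∈ F, ∀ i, z' c i = (t' c i).2 := fun c hc i => if_neg (hne c hc)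
  have z'_bdry : ∀ c ∈ F, ∀ i i', (b, i') ≠ (b, true) →
      ZeroOneSet.sub (z' c i) b i' = ZeroOneSet.sub (z' b i') c i := fun c hc i i' hi' => by
    rw [z'_of c hc, z'_b]
    cases i'
    · exact congrArg Prod.snd (t'_start c hc i)
    · exact absurd rfl hi'
  -- Taking h q as base makes the two components agree in W.
  obtain ⟨z, hz, hzq, hzH⟩ := G.exists_invariant_filler H' (Finset.mem_insert_self b F) z' (h q)
    hHF' (fun π hπ => hπ.2)
    (fun π hπ c hc i _ => by
      have hπb : π • b = b := hπ.2
      rcases Finset.mem_insert.1 hc with rfl | hc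
      · rw [hπb, z'_b, ← map_smul, hHx₀ π hπ.1]
      · rw [z'_of _ (hHF π hπ.1 c hc), z'_of c hc, t'_smul π hπ c hc]
        rfl)
    (fun π hπ => by rw [← map_smul, hqH π hπ])
    (fun c hc i _ => by
      rcases Finset.mem_insert.1 hc with rfl | hc
      · rw [z'_b]
        exact hbx.map _ (map_smul k)
      · rw [z'_of c hc]
        exact (t'_fresh c hc i).map Prod.snd fun _ _ => rfl)
    (fun c hc i hi c' hc' i' hi' hcc' => by
      rcases Finset.mem_insert.1 hc with rfl | hc
      · exact (z'_bdry c' ((Finset.mem_insert.1 hc').resolve_left (Ne.symm hcc')) i' i hi).symm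
      · rcases Finset.mem_insert.1 hc' with rfl | hc'
        · exact z'_bdry c ((Finset.mem_insert.1 hc).resolve_left hcc') i i' hi'
        · rw [z'_of c hc, z'_of c' hc']
          exact congrArg Prod.snd (t'_adj c hc i c' hc' i' hcc'))
    (fun c hc i hi => by
      rw [← map_sub, hq c hc]
      rcases Finset.mem_insert.1 hc with rfl | hc
      · rw [z'_b, u_b]
        cases i
        · exact (sq x₀).symm
        · exact absurd rfl hi
      · rw [z'_of c hc, u_of c hc, (hψ _ (low c hc i)).1.base b _ (t'_mk c hc i)])
  have hq_b : ∀ i, ZeroOneSet.sub q b i = cond i w (reflMap f x₀) := fun i =>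
    (hq b (Finset.mem_insert_self b F) i).trans (u_b i)
  refine ⟨NameAbs.mk b (q, z), ?_, fun c hc i => ?_, ?_⟩
  · exact
      { start := Prod.ext (hq_b false)
          ((hz b (Finset.mem_insert_self b F) false (by simp)).trans (z'_b false))
        finish := hq_b true
        source := fun b' q' hq' => by
          rw [eq_of_mk_eq_mk (fun q : nameAbsOver f × Z => sourceMap f q.1)
            (fun π q => map_smul (sourceMap f) π q.1) hq' (by dsimp only; rwa [hqx])]
          exact hqx
        base := fun b' q' hq' => by
          obtain ⟨-, rfl⟩ := NameAbs.mk_eq_mk.1 hq'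
          change h (swap b b' • q) = g (swap b b' • z)
          rw [map_smul, map_smul, hzq]
        refl := fun x hx => absurd ⟨x, hx⟩ hw }
  · change NameAbs.sub (NameAbs.mk b (q, z)) c i = _
    have hc' := Finset.mem_insert_of_mem (b := b) hc
    rw [NameAbs.sub_mk (Ne.symm (hne c hc)), t'_mk c hc i]
    congr 1
    exact Prod.ext ((hq c hc' i).trans (u_of c hc i))
      ((hz c hc' i fun h => hne c hc (Prod.mk.inj h).1).trans (z'_of c hc i))
  · exact fun π hπ => NameAbs.smul_mk_eq_of_invariant hHF hFH hb (fun τ hτ hτb =>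
      Prod.ext (hqH τ ⟨hτ, hτb⟩) (hzH τ ⟨hτ, hτb⟩)) π hπ

theorem leftMaps_reflMap (hf : kanFibrations 𝔸 f) : leftMaps 𝔸 (reflMap f) := by
  intro Z W g hg
  refine ⟨fun {k h} sq => ?_⟩
  obtain ⟨K⟩ := hf.1
  obtain ⟨G⟩ := hg.1
  have hsq : ∀ x, h (reflMap f x) = g (k x) := fun x =>
    (congrFun (congrArg Hom.toFun sq.w) x).symm
  obtain ⟨φ, h_smul, h_sub, hφ⟩ := exists_morphism_of_step (𝔸 := 𝔸) (IsContraction k g h)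
    (fun w => NameAbs.degen 𝔸 (reflMap f (sourceMap f w), k (sourceMap f w)))
    (fun π _ _ ht => ht.smul π) (exists_isContraction K G hsq)
  -- The upper triangle commutes by `refl`; the lower one by `base`, evaluated at the end of the
  -- contraction, together with `finish`.
  let l : nameAbsOver f ⟶ Z := Hom.mk (fun w => (NameAbs.endpoint true (φ w)).2)
    (fun π w => by
      rw [h_smul, NameAbs.endpoint_smul]
      rfl)
    (fun w c i => by
      rw [h_sub, NameAbs.endpoint_sub]
      rfl)
  refine ⟨⟨l, Hom.ext (funext fun x => ?_), Hom.ext (funext fun w => ?_)⟩⟩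
  · change (NameAbs.endpoint true (φ (reflMap f x))).2 = k x
    rw [(hφ _).refl x rfl, NameAbs.endpoint_degen]
  · change g (NameAbs.endpoint true (φ w)).2 = h w
    obtain ⟨b, q, -, hq⟩ := NameAbs.exists_rep ∅ (φ w)
    have h1 := (hφ w).finish
    rw [hq] at h1 ⊢
    change ZeroOneSet.sub q.1 b true = w at h1
    change g (ZeroOneSet.sub q.2 b true) = h w
    rw [map_sub, ← (hφ w).base b q hq, ← map_sub, h1]

end Reflexivity

end NomCube

theorem mainTheorem9 {𝔸 : Type u} [DecidableEq 𝔸] [Infinite 𝔸] {X Y : NomCube.ZeroOneSub 𝔸}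
    (f : X ⟶ Y) (hf : NomCube.kanFibrations 𝔸 f) :
    NomCube.IsPathObject (NomCube.leftMaps 𝔸) (NomCube.kanFibrations 𝔸)
      (NomCube.isPullback_fibreProd f) (NomCube.reflMap f) (NomCube.endpointsMap f) where
  fac := by
    refine (NomCube.isPullback_fibreProd f).hom_ext ?_ ?_
    · rw [IsPullback.lift_fst]
      exact NomCube.Hom.ext (funext fun x => NomCube.NameAbs.endpoint_degen false x)
    · rw [IsPullback.lift_snd]
      exact NomCube.Hom.ext (funext fun x => NomCube.NameAbs.endpoint_degen true x)
  left := NomCube.leftMaps_reflMap hf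
  right := NomCube.kanFibrations_endpointsMap hf
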